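/- **Setting.** Let $a>b>0$ and let $\mathcal E:\ x^2/a+y^2/b=1$ in the Euclidean plane, regarded as part of the real projective plane $\mathbf P^2$. The confocal system $\mathcal F$ of $\mathcal E$ is the family of conics whose projective dual is the pencil spanned by the dual conics with matrices $\mathrm{diag}(a,b,-1)$ and $\mathrm{diag}(1,1,0)$; it consists of the conics $\frac{x^2}{a-t}+\frac{y^2}{b-t}=1$ ($t\in\mathbf R\setminus\{a,b\}$) and of the degenerate members $x=0$, $y=0$ and the line at infinity (the tangent line of a degenerate member at each of its points being that line itself). **Reflection.** Let $x$ be a point of $\mathcal Q_1\in\mathcal F$, $u$ the tangent line of $\mathcal Q_1$ at $x$, and $z\ne x$ the pole of $u$ with respect to a nondegenerate conic $\mathcal Q_2\in\mathcal F$. Lines $\ell_1,\ell_2$ through $x$ *obey the reflection law* at $x$ on $\mathcal Q_1$ if they are harmonically conjugate with respect to the lines $xz$ and $u$, that is, exchanged by the involution of the pencil of lines through $x$ whose fixed lines are $xz$ and $u$ (the cases $\ell_1=\ell_2=u$ and $\ell_1=\ell_2=xz$ are included). A sequence of lines $(\ell_i)_{i\in\mathbf Z}$ is a *billiard trajectory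 within* $\mathcal Q\in\mathcal F$ if there are points $x_i\in\mathcal Q$ such that, for all $i$, $\ell_{i-1},\ell_i$ obey the reflection law at $x_i$ on $\mathcal Q$ and $\ell_i\cap\mathcal Q=\{x_i,x_{i+1}\}$. **Double reflection configurations and nets.** Lines $\ell,\ell_1,\ell_2,\ell_{12}$ form a *double reflection configuration* on $\mathcal Q_1,\mathcal Q_2\in\mathcal F$ if there are points $x_1,x_2\in\mathcal Q_1$ and $y_1,y_2\in\mathcal Q_2$ such that the pairs $\ell,\ell_1$ and $\ell_2,\ell_{12}$ obey the reflection law on $\mathcal Q_1$ at $x_1$ and $x_2$ respectively, the pairs $\ell,\ell_2$ and $\ell_1,\ell_{12}$ obey it on $\mathcal Q_2$ at $y_1$ and $y_2$ respectively, and the four tangent lines, to $\mathcal Q_1$ at $x_1,x_2$ and to $\mathcal Q_2$ at $y_1,y_2$, belong to a pencil (pass through one point of $\mathbf P^2$). Let $\mathcal C\in\mathcal F$ and let $\mathcal A$ be the set of lines touching $\mathcal C$. A map $\varphi:\mathbf Z^m\to\mathcal A$ is a *double reflection net* if there are $\mathcal Q_1,\dots,\mathcal Q_m\in\mathcal F$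 such that 1. for every $j$ and every $\mathbf n\in\mathbf Z^m$, the sequence $(\varphi(\mathbf n+i\mathbf e_j))_{i\in\mathbf Z}$ is a billiard trajectory within $\mathcal Q_j$; 2. for all $i\ne j$ and every $\mathbf n\in\mathbf Z^m$, the lines $\varphi(\mathbf n),\varphi(\mathbf n+\mathbf e_i),\varphi(\mathbf n+\mathbf e_j),\varphi(\mathbf n+\mathbf e_i+\mathbf e_j)$ form a double reflection configuration on $\mathcal Q_i,\mathcal Q_j$. **Proposition.** Let $(a_i)_{i\in\mathbf Z}$ be a billiard trajectory within $\mathcal E$ in the usual Euclidean sense: $a_i$ is the line through $p_i\neq p_{i+1}$, where $p_i\in\mathcal E$ for all $i\in\mathbf Z$ and the direction of motion is reflected in the tangent line of $\mathcal E$ at each $p_i$. Suppose that its caustic is an ellipse, that is, some line $a_i$ touches a confocal ellipse $\mathcal C:\ \frac{x^2}{a-c}+\frac{y^2}{b-c}=1$, $c<b$. Let $k_1,\dots,k_m$ be positive integers. Then all the lines $a_{n_1k_1+\dots+n_mk_m}$ ($n_1,\dots,n_m\in\mathbf Z$) touch $\mathcal C$, and the map $$\varphi_D:\ \mathbf Z^m\to\mathcal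 A,\qquad \varphi_D(n_1,\dots,n_m)=a_{n_1k_1+\dots+n_mk_m},$$ is a double reflection net, where $\mathcal A$ is the set of lines touching $\mathcal C$. -/

import Mathlib

open scoped LinearAlgebra.Projectivization Matrix

noncomputable section

namespace DoubleReflection

/-- Points of the real projective plane, in homogeneous coordinates `[x : y : w]`; the Euclidean
plane is the chart `w = 1`. -/
abbrev Pt : Type := ℙ ℝ (Fin 3 → ℝ)

/-- Lines of the real projective plane, given by their dual homogeneous coordinates: `[p : q : r]`
is the line `p x + q y + r w = 0`. -/
abbrev Ln : Type := ℙ ℝ (Fin 3 → ℝ)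

/-- The point `x` lies on the line `l`. -/
def On (x : Pt) (l : Ln) : Prop := Projectivization.orthogonal x l

/-! ### Conics and confocal systems -/

/-- The point `x` lies on the conic `(Q ξ, ξ) = 0`. -/
def OnConic (Q : Matrix (Fin 3) (Fin 3) ℝ) (x : Pt) : Prop :=
  x.rep ⬝ᵥ (Q *ᵥ x.rep) = 0

/-- The line `u` is the polar of the point `z` (and, for a nondegenerate conic, `z` is the pole of
`u`) with respect to the conic `Q`. -/
def IsPolar (Q : Matrix (Fin 3) (Fin 3) ℝ) (z : Pt) (u : Ln) : Prop :=
  ∃ c : ℝ, c ≠ 0 ∧ Q *ᵥ z.rep = c • u.rep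

/-- The line `u` is the tangent line to the conic `Q` at the point `x`: the polar of `x`, where `x`
lies on `Q`. If the conic degenerates to a (double) line, its tangent line at each of its points is
that line itself. -/
def TangentAt (Q : Matrix (Fin 3) (Fin 3) ℝ) (x : Pt) (u : Ln) : Prop :=
  OnConic Q x ∧ (IsPolar Q x u ∨ (Q *ᵥ x.rep = 0 ∧ ∀ y : Pt, OnConic Q y ↔ On y u))

/-- The line `l` touches the conic `Q`. -/
def Touches (l : Ln) (Q : Matrix (Fin 3) (Fin 3) ℝ) : Prop := ∃ x : Pt, TangentAt Q x l

/-- The confocal system whose projective dual is the pencil of conics spanned by `D₁` and `D₂`: its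
members are the conics dual to the members of the pencil (the matrix of the dual conic is the
adjugate, and the matrix of a conic matters only up to a nonzero factor). -/
def confocalSystem (D₁ D₂ : Matrix (Fin 3) (Fin 3) ℝ) : Set (Matrix (Fin 3) (Fin 3) ℝ) :=
  {Q | ∃ s t r : ℝ, (s, t) ≠ (0, 0) ∧ r ≠ 0 ∧ Q = r • (s • D₁ + t • D₂).adjugate}

/-- The conic `x² / α + y² / β = w²`. -/
def axisConic (α β : ℝ) : Matrix (Fin 3) (Fin 3) ℝ :=
  Matrix.diagonal ![1 / α, 1 / β, -1]

/-- The confocal system of `x² / a + y² / b = 1` in the Euclidean plane. Its members are the conics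
`x² / (a - t) + y² / (b - t) = 1` with `t ≠ a, b` and the degenerate members `x = 0`, `y = 0` and
the line at infinity. -/
def confocalOf (a b : ℝ) : Set (Matrix (Fin 3) (Fin 3) ℝ) :=
  confocalSystem (Matrix.diagonal ![a, b, -1]) (Matrix.diagonal ![1, 1, 0])

/-! ### Reflection -/

/-- The lines `l₁`, `l₂` are harmonically conjugate with respect to the two distinct lines `n`, `u`
of the pencil that they span: `l₁ = α n + β u` and `l₂ = α n - β u` up to scaling. The fixed lines
`n` and `u` of this involution are conjugate to themselves. -/
def HarmonicLines (l₁ l₂ n u : Ln) : Prop :=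
  n ≠ u ∧ ∃ α β γ : ℝ, γ ≠ 0 ∧
    l₁.rep = α • n.rep + β • u.rep ∧ γ • l₂.rep = α • n.rep - β • u.rep

/-- The lines `l₁` and `l₂` obey the reflection law at the point `x` of the conic `Q₁` with respect
to the confocal system `F`: with `u` the tangent of `Q₁` at `x` and `z` the pole of `u` with
respect to another, nondegenerate, conic `Q₂` of `F`, the lines `l₁`, `l₂`, `n = xz`, `u` pass
through `x` and are harmonically conjugate. -/
def ReflectionLaw (F : Set (Matrix (Fin 3) (Fin 3) ℝ)) (Q₁ : Matrix (Fin 3) (Fin 3) ℝ)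
    (x : Pt) (l₁ l₂ : Ln) : Prop :=
  On x l₁ ∧ On x l₂ ∧ ∃ u : Ln, TangentAt Q₁ x u ∧
    ∃ Q₂ ∈ F, Q₂.det ≠ 0 ∧ ∃ z : Pt, IsPolar Q₂ z u ∧ z ≠ x ∧
      ∃ n : Ln, On x n ∧ On z n ∧ HarmonicLines l₁ l₂ n u

/-- The sequence of lines `l` is a billiard trajectory within the conic `Q` of the confocal system
`F`: consecutive lines `l (i - 1)`, `l i` obey the reflection law at a point `x i` of `Q`, and the
points where `l i` meets `Q` are exactly the two impact points `x i` and `x (i + 1)` on it. -/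
def IsBilliardTrajectory (F : Set (Matrix (Fin 3) (Fin 3) ℝ)) (Q : Matrix (Fin 3) (Fin 3) ℝ)
    (l : ℤ → Ln) : Prop :=
  ∃ x : ℤ → Pt, ∀ i : ℤ, ReflectionLaw F Q (x i) (l (i - 1)) (l i) ∧
    {y : Pt | On y (l i) ∧ OnConic Q y} = {x i, x (i + 1)}

/-- The lines `l`, `l₁`, `l₂`, `l₁₂` form a double reflection configuration on the conics `Q₁`, `Q₂`
of the confocal system `F`. They are the sides `x₁y₁`, `x₁y₂`, `y₁x₂`, `y₂x₂` of a quadrilateral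
with `x₁`, `x₂` on `Q₁` and `y₁`, `y₂` on `Q₂`; the reflection law holds at each vertex (virtual
reflection configuration), and the tangent lines at the four vertices belong to a pencil. -/
def IsDoubleReflectionConfiguration (F : Set (Matrix (Fin 3) (Fin 3) ℝ))
    (Q₁ Q₂ : Matrix (Fin 3) (Fin 3) ℝ) (l l₁ l₂ l₁₂ : Ln) : Prop :=
  ∃ x₁ x₂ y₁ y₂ : Pt,
    ReflectionLaw F Q₁ x₁ l l₁ ∧ ReflectionLaw F Q₁ x₂ l₂ l₁₂ ∧
    ReflectionLaw F Q₂ y₁ l l₂ ∧ ReflectionLaw F Q₂ y₂ l₁ l₁₂ ∧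
    ∃ u₁ u₂ v₁ v₂ : Ln, TangentAt Q₁ x₁ u₁ ∧ TangentAt Q₁ x₂ u₂ ∧
      TangentAt Q₂ y₁ v₁ ∧ TangentAt Q₂ y₂ v₂ ∧
      ∃ p : Pt, On p u₁ ∧ On p u₂ ∧ On p v₁ ∧ On p v₂

/-- `φ` is a double reflection net in the plane, for the confocal system `F` and its fixed member
`C`: a map from `ℤᵐ` to the set of lines touching `C`, with conics `Q₁, …, Qₘ` from `F` such that
each coordinate direction `j` gives billiard trajectories within `Qⱼ`, and each elementary
quadrilateral gives a double reflection configuration. -/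
def IsDoubleReflectionNet (F : Set (Matrix (Fin 3) (Fin 3) ℝ)) (C : Matrix (Fin 3) (Fin 3) ℝ)
    {m : ℕ} (φ : (Fin m → ℤ) → Ln) : Prop :=
  C ∈ F ∧ (∀ n, Touches (φ n) C) ∧
  ∃ Q : Fin m → Matrix (Fin 3) (Fin 3) ℝ, (∀ j, Q j ∈ F) ∧
    (∀ (j : Fin m) (n : Fin m → ℤ),
      IsBilliardTrajectory F (Q j) (fun i : ℤ => φ (n + i • Pi.single j 1))) ∧
    (∀ (i j : Fin m), i ≠ j → ∀ n : Fin m → ℤ,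
      IsDoubleReflectionConfiguration F (Q i) (Q j) (φ n) (φ (n + Pi.single i 1))
        (φ (n + Pi.single j 1)) (φ (n + Pi.single i 1 + Pi.single j 1)))

/-! ### The Euclidean billiard within an ellipse -/

theorem affine_ne_zero (p : EuclideanSpace ℝ (Fin 2)) : (![p 0, p 1, 1] : Fin 3 → ℝ) ≠ 0 := by
  intro h
  simpa using congrFun h 2

/-- The point `[x : y : 1]` of the projective plane given by the point `(x, y)` of the Euclidean
plane. -/
def affinePt (p : EuclideanSpace ℝ (Fin 2)) : Pt :=
  Projectivization.mk ℝ ![p 0, p 1, 1] (affine_ne_zero p)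

/-- A normal vector at `p` of the ellipse `x² / a + y² / b = 1`. -/
def ellipseNormal (a b : ℝ) (p : EuclideanSpace ℝ (Fin 2)) : EuclideanSpace ℝ (Fin 2) :=
  !₂[p 0 / a, p 1 / b]

/-- The unit direction from `p` to `q`. -/
def dir (p q : EuclideanSpace ℝ (Fin 2)) : EuclideanSpace ℝ (Fin 2) :=
  ‖q - p‖⁻¹ • (q - p)

/-- The lines `l i` are the successive segments, extended, of a billiard trajectory within the
ellipse `x² / a + y² / b = 1` of the Euclidean plane: there are impact points `p i` on the ellipse
such that `l i` joins the distinct points `p i` and `p (i + 1)`, and at each impact the direction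
of motion is reflected in the tangent line (angle of incidence = angle of reflection). -/
def IsEllipseBilliard (a b : ℝ) (l : ℤ → Ln) : Prop :=
  ∃ p : ℤ → EuclideanSpace ℝ (Fin 2), ∀ i : ℤ,
    (p i) 0 ^ 2 / a + (p i) 1 ^ 2 / b = 1 ∧
    p i ≠ p (i + 1) ∧
    On (affinePt (p i)) (l i) ∧ On (affinePt (p (i + 1))) (l i) ∧
    (Submodule.span ℝ {ellipseNormal a b (p i)})ᗮ.reflection (dir (p (i - 1)) (p i)) =
      dir (p i) (p (i + 1))

end DoubleReflection

end

noncomputable section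

namespace DoubleReflection

/-! ### Jacobi elliptic functions -/

/-! The tangent lines of the caustic are uniformized by Jacobi elliptic functions whose parameter is
its squared eccentricity: `tangentLine u` touches the ellipse with semi-axes `α`, `β` at `(α sn u, β
cn u)`. The addition theorem gives `sn (m + h) sn m dn h + cn (m + h) cn m = cn h`. Hence the
tangents `m - h` and `m + h` meet at `[α sn m dn h : β cn m : cn h]`, which for fixed `h` runs over
one confocal conic, `shiftConic h`. There they are harmonic with respect to its tangent and normal
(`harmonicLines_impact`), so they obey the reflection law.

Therefore reflection within the given ellipse is translation of the parameter by a constant `2 h`,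
and the trajectory is an arithmetic progression of parameters (`exists_tangentLine_eq`). Every
`k`-th line is again such a progression, with step `2 k h`, hence a billiard trajectory within
`shiftConic (k h)` (`isBilliardTrajectory_tangentLine`). An elementary square of the net has
parameters `M ± h ± h'`, and the identity above, used once more, shows that the tangents at its four
vertices concur (`isDoubleReflectionConfiguration_tangentLine`).

Homogeneous coordinates treat uniformly the degenerate steps: `cn h = 0`, when the lines meet at
infinity, and `sn h = 0`, when they coincide. -/

/-- Jacobi elliptic functions of parameter `q` (the square of the modulus). -/
structure JacobiFunctions (q : ℝ) where
  sn : ℝ → ℝ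
  cn : ℝ → ℝ
  dn : ℝ → ℝ
  sq_add_sq : ∀ u, sn u ^ 2 + cn u ^ 2 = 1
  dn_sq : ∀ u, dn u ^ 2 = 1 - q * sn u ^ 2
  dn_pos : ∀ u, 0 < dn u
  sn_add : ∀ u v, (1 - q * sn u ^ 2 * sn v ^ 2) * sn (u + v) =
    sn u * cn v * dn v + sn v * cn u * dn u
  cn_add : ∀ u v, (1 - q * sn u ^ 2 * sn v ^ 2) * cn (u + v) =
    cn u * cn v - sn u * dn u * sn v * dn v
  sn_neg : ∀ u, sn (-u) = -sn u
  cn_neg : ∀ u, cn (-u) = cn u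
  surj : ∀ x y : ℝ, x ^ 2 + y ^ 2 = 1 → ∃ u, sn u = x ∧ cn u = y

/-! ### The amplitude as inverse of the elliptic integral -/

theorem one_sub_mul_sin_sq_pos {q : ℝ} (hq0 : 0 ≤ q) (hq1 : q < 1) (t : ℝ) :
    0 < 1 - q * Real.sin t ^ 2 := by
  nlinarith [Real.sin_sq_le_one t, sq_nonneg (Real.sin t)]

/-- The incomplete elliptic integral of the first kind. -/
def ellipticIntegral (q θ : ℝ) : ℝ := ∫ t in (0 : ℝ)..θ, (√(1 - q * Real.sin t ^ 2))⁻¹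

section
variable {q : ℝ} (hq0 : 0 ≤ q) (hq1 : q < 1)
include hq0 hq1

theorem continuous_ellipticIntegrand :
    Continuous fun t : ℝ => (√(1 - q * Real.sin t ^ 2))⁻¹ := by
  refine Continuous.inv₀ (by fun_prop) fun t => ?_
  exact (Real.sqrt_pos.2 (one_sub_mul_sin_sq_pos hq0 hq1 t)).ne'

theorem hasDerivAt_ellipticIntegral (θ : ℝ) :
    HasDerivAt (ellipticIntegral q) (√(1 - q * Real.sin θ ^ 2))⁻¹ θ :=
  (continuous_ellipticIntegrand hq0 hq1).integral_hasStrictDerivAt 0 θ |>.hasDerivAt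

theorem strictMono_ellipticIntegral : StrictMono (ellipticIntegral q) := by
  refine strictMono_of_deriv_pos fun θ => ?_
  rw [(hasDerivAt_ellipticIntegral hq0 hq1 θ).deriv]
  exact inv_pos.2 (Real.sqrt_pos.2 (one_sub_mul_sin_sq_pos hq0 hq1 θ))

theorem continuous_ellipticIntegral : Continuous (ellipticIntegral q) :=
  continuous_iff_continuousAt.2 fun θ => (hasDerivAt_ellipticIntegral hq0 hq1 θ).continuousAt

omit hq0 hq1 in
theorem ellipticIntegral_neg (θ : ℝ) : ellipticIntegral q (-θ) = -ellipticIntegral q θ := by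
  have h := intervalIntegral.integral_comp_neg (a := 0) (b := θ)
    (fun t => (√(1 - q * Real.sin t ^ 2))⁻¹)
  simp only [Real.sin_neg, neg_sq, neg_zero] at h
  rw [ellipticIntegral, ellipticIntegral, h, intervalIntegral.integral_symm]

/-- The integrand is at least 1. This linear growth makes the integral unbounded, hence surjective.
-/
theorem le_ellipticIntegral {θ : ℝ} (hθ : 0 ≤ θ) : θ ≤ ellipticIntegral q θ := by
  have h : ∫ _ in (0 : ℝ)..θ, (1 : ℝ) ≤ ellipticIntegral q θ := by
    refine intervalIntegral.integral_mono_on hθ (by simp)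
      ((continuous_ellipticIntegrand hq0 hq1).intervalIntegrable _ _) fun t _ => ?_
    have hp := Real.sqrt_pos.2 (one_sub_mul_sin_sq_pos hq0 hq1 t)
    refine (one_le_inv₀ hp).2 (Real.sqrt_le_one.2 ?_)
    nlinarith [sq_nonneg (Real.sin t)]
  simpa using h

theorem surjective_ellipticIntegral : Function.Surjective (ellipticIntegral q) := by
  have htop : Filter.Tendsto (ellipticIntegral q) .atTop .atTop := by
    refine Filter.tendsto_atTop_mono' _ ?_ Filter.tendsto_id
    filter_upwards [Filter.eventually_ge_atTop 0] with θ hθ using le_ellipticIntegral hq0 hq1 hθ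
  refine (continuous_ellipticIntegral hq0 hq1).surjective htop ?_
  have := Filter.tendsto_neg_atTop_atBot.comp (htop.comp Filter.tendsto_neg_atBot_atTop)
  refine this.congr fun θ => ?_
  simp [ellipticIntegral_neg]

theorem exists_amplitude : ∃ am : ℝ → ℝ, Function.Surjective am ∧ (∀ u, am (-u) = -am u) ∧
    ∀ u, HasDerivAt am (√(1 - q * Real.sin (am u) ^ 2)) u := by
  let e := (strictMono_ellipticIntegral hq0 hq1).orderIsoOfSurjective _
    (surjective_ellipticIntegral hq0 hq1)
  have he : ∀ u, ellipticIntegral q (e.symm u) = u := fun u => e.apply_symm_apply u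
  refine ⟨e.symm, e.symm.surjective, fun u => ?_, fun u => ?_⟩
  · refine (strictMono_ellipticIntegral hq0 hq1).injective ?_
    rw [he, ellipticIntegral_neg, he]
  · have h := HasDerivAt.of_local_left_inverse (f := ellipticIntegral q) (g := e.symm) (a := u)
      e.symm.continuous.continuousAt (hasDerivAt_ellipticIntegral hq0 hq1 _)
      (inv_ne_zero (Real.sqrt_pos.2 (one_sub_mul_sin_sq_pos hq0 hq1 _)).ne')
      (Filter.Eventually.of_forall he)
    simpa using h

end

/-! ### Addition theorems -/

section
variable {q : ℝ} {s c d : ℝ → ℝ} (h1 : ∀ u, s u ^ 2 + c u ^ 2 = 1)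
  (h2 : ∀ u, d u ^ 2 = 1 - q * s u ^ 2) (hd : ∀ u, 0 < d u)
include h1 h2 hd

theorem one_sub_mul_sq_mul_sq_pos (u v : ℝ) : 0 < 1 - q * s u ^ 2 * s v ^ 2 := by
  have hx : q * s u ^ 2 < 1 := by have := h2 u; have := pow_pos (hd u) 2; linarith
  have hy : s v ^ 2 ≤ 1 := by have := h1 v; nlinarith [sq_nonneg (c v)]
  rcases hy.lt_or_eq with h | h
  · nlinarith [sq_nonneg (s v)]
  · rw [h]; linarith

variable (hs : ∀ u, HasDerivAt s (c u * d u) u) (hc : ∀ u, HasDerivAt c (-(s u * d u)) u)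
  (hd' : ∀ u, HasDerivAt d (-(q * s u * c u)) u)
  (s0 : s 0 = 0) (c0 : c 0 = 1) (d0 : d 0 = 1)
include hs hc hd' s0 c0 d0

/-- With `u + v` held fixed, the quotient given by the addition formula for the arguments `x` and `u
+ v - x` has zero derivative in `x`. Its values at `x = u` and `x = 0` are compared. -/
theorem sn_add_of_deriv (u v : ℝ) : (1 - q * s u ^ 2 * s v ^ 2) * s (u + v) =
    s u * c v * d v + s v * c u * d u := by
  let F : ℝ → ℝ := fun x => (s x * c (u + v - x) * d (u + v - x) + s (u + v - x) * c x * d x) /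
    (1 - q * s x ^ 2 * s (u + v - x) ^ 2)
  have hF : ∀ x, HasDerivAt F 0 x := by
    intro x
    have r : HasDerivAt (fun x => u + v - x) (-1) x := by
      simpa using (hasDerivAt_id x).const_sub (u + v)
    have rs := (hs (u + v - x)).comp x r
    have rc := (hc (u + v - x)).comp x r
    have rd := (hd' (u + v - x)).comp x r
    have hD := one_sub_mul_sq_mul_sq_pos h1 h2 hd x (u + v - x)
    have := ((((hs x).mul rc).mul rd).add ((rs.mul (hc x)).mul (hd' x))).div
      (((((hs x).pow 2).const_mul q).mul (rs.pow 2)).const_sub 1) hD.ne'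
    refine this.congr_deriv ?_
    simp only [Function.comp_apply, Pi.mul_apply, Pi.pow_apply, Pi.add_apply]
    generalize u + v - x = y at *
    have e1 := h1 x; have e2 := h1 y; have e3 := h2 x; have e4 := h2 y
    rw [div_eq_zero_iff]; left
    have e1 : c x ^ 2 = 1 - s x ^ 2 := by linarith
    have e2 : c y ^ 2 = 1 - s y ^ 2 := by linarith
    generalize s x = sx at *; generalize c x = cx at *; generalize d x = dx at *
    generalize s y = sy at *; generalize c y = cy at *; generalize d y = dy at *
    ring_nf
    simp only [e1, e2, e3, e4]
    ring
  have h := is_const_of_deriv_eq_zero (fun x => (hF x).differentiableAt)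
    (fun x => (hF x).deriv) u 0
  have hD := one_sub_mul_sq_mul_sq_pos h1 h2 hd u v
  simp only [F, s0, c0, d0, add_sub_cancel_left] at h
  rw [div_eq_iff hD.ne'] at h
  rw [h]; simp; ring

theorem cn_add_of_deriv (u v : ℝ) : (1 - q * s u ^ 2 * s v ^ 2) * c (u + v) =
    c u * c v - s u * d u * s v * d v := by
  let F : ℝ → ℝ := fun x => (c x * c (u + v - x) - s x * d x * s (u + v - x) * d (u + v - x)) /
    (1 - q * s x ^ 2 * s (u + v - x) ^ 2)
  have hF : ∀ x, HasDerivAt F 0 x := by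
    intro x
    have r : HasDerivAt (fun x => u + v - x) (-1) x := by
      simpa using (hasDerivAt_id x).const_sub (u + v)
    have rs := (hs (u + v - x)).comp x r
    have rc := (hc (u + v - x)).comp x r
    have rd := (hd' (u + v - x)).comp x r
    have hD := one_sub_mul_sq_mul_sq_pos h1 h2 hd x (u + v - x)
    have := (((hc x).mul rc).sub ((((hs x).mul (hd' x)).mul rs).mul rd)).div
      (((((hs x).pow 2).const_mul q).mul (rs.pow 2)).const_sub 1) hD.ne'
    refine this.congr_deriv ?_
    simp only [Function.comp_apply, Pi.mul_apply, Pi.pow_apply, Pi.sub_apply]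
    generalize u + v - x = y at *
    have e1 := h1 x; have e2 := h1 y; have e3 := h2 x; have e4 := h2 y
    rw [div_eq_zero_iff]; left
    have e1 : c x ^ 2 = 1 - s x ^ 2 := by linarith
    have e2 : c y ^ 2 = 1 - s y ^ 2 := by linarith
    generalize s x = sx at *; generalize c x = cx at *; generalize d x = dx at *
    generalize s y = sy at *; generalize c y = cy at *; generalize d y = dy at *
    ring_nf
    simp only [e1, e2, e3, e4]
    ring
  have h := is_const_of_deriv_eq_zero (fun x => (hF x).differentiableAt)
    (fun x => (hF x).deriv) u 0
  have hD := one_sub_mul_sq_mul_sq_pos h1 h2 hd u v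
  simp only [F, s0, c0, d0, add_sub_cancel_left] at h
  rw [div_eq_iff hD.ne'] at h
  rw [h]; simp; ring

end

theorem nonempty_jacobiFunctions {q : ℝ} (hq0 : 0 ≤ q) (hq1 : q < 1) :
    Nonempty (JacobiFunctions q) := by
  obtain ⟨am, hsurj, hneg, hder⟩ := exists_amplitude hq0 hq1
  have am0 : am 0 = 0 := by have := hneg 0; simp at this; linarith
  have hp := fun u => one_sub_mul_sin_sq_pos hq0 hq1 (am u)
  let s := fun u => Real.sin (am u)
  let c := fun u => Real.cos (am u)
  let d := fun u => √(1 - q * Real.sin (am u) ^ 2)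
  have h1 : ∀ u, s u ^ 2 + c u ^ 2 = 1 := fun u => Real.sin_sq_add_cos_sq _
  have h2 : ∀ u, d u ^ 2 = 1 - q * s u ^ 2 := fun u => Real.sq_sqrt (hp u).le
  have hd : ∀ u, 0 < d u := fun u => Real.sqrt_pos.2 (hp u)
  have hs : ∀ u, HasDerivAt s (c u * d u) u := fun u => (hder u).sin
  have hc : ∀ u, HasDerivAt c (-(s u * d u)) u := fun u => by
    simpa using (hder u).cos
  have hd' : ∀ u, HasDerivAt d (-(q * s u * c u)) u := fun u => by
    have := ((((hs u).pow 2).const_mul q).const_sub 1).sqrt (hp u).ne'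
    refine this.congr_deriv ?_
    change _ / (2 * d u) = _
    have := (hd u).ne'
    field_simp
    simp
    ring
  have s0 : s 0 = 0 := by simp [s, am0]
  have c0 : c 0 = 1 := by simp [c, am0]
  have d0 : d 0 = 1 := by simp [d, am0]
  refine ⟨⟨s, c, d, h1, h2, hd, sn_add_of_deriv h1 h2 hd hs hc hd' s0 c0 d0,
    cn_add_of_deriv h1 h2 hd hs hc hd' s0 c0 d0, fun u => by simp [s, hneg],
    fun u => by simp [c, hneg], fun x y hxy => ?_⟩⟩
  -- The argument of `y + x i` has cosine `y` and sine `x`; it is an amplitude because `am` is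
  -- surjective.
  have hz : ‖(⟨y, x⟩ : ℂ)‖ = 1 := by
    rw [Complex.norm_def, Complex.normSq_mk]; simp; nlinarith
  obtain ⟨u, hu⟩ := hsurj (Complex.arg ⟨y, x⟩)
  have h0 : (⟨y, x⟩ : ℂ) ≠ 0 := by
    intro h; rw [h] at hz; simp at hz
  refine ⟨u, ?_, ?_⟩
  · simp [s, hu, Complex.sin_arg, hz]
  · simp [c, hu, Complex.cos_arg h0, hz]

/-! ### The projective plane in homogeneous coordinates -/

theorem exists_rep_mk_eq_smul {v : Fin 3 → ℝ} (hv : v ≠ 0) :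
    ∃ t : ℝ, t ≠ 0 ∧ (Projectivization.mk ℝ v hv).rep = t • v := by
  obtain ⟨t, ht⟩ := Projectivization.exists_smul_eq_mk_rep ℝ v hv
  exact ⟨t, t.ne_zero, ht.symm⟩

theorem on_mk_iff {v w : Fin 3 → ℝ} (hv : v ≠ 0) (hw : w ≠ 0) :
    On (Projectivization.mk ℝ v hv) (Projectivization.mk ℝ w hw) ↔
      v 0 * w 0 + v 1 * w 1 + v 2 * w 2 = 0 := by
  rw [On, Projectivization.orthogonal_mk hv hw, dotProduct, Fin.sum_univ_three]

theorem onConic_diagonal_mk_iff {x y z : ℝ} {v : Fin 3 → ℝ} (hv : v ≠ 0) :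
    OnConic (Matrix.diagonal ![x, y, z]) (Projectivization.mk ℝ v hv) ↔
      x * v 0 ^ 2 + y * v 1 ^ 2 + z * v 2 ^ 2 = 0 := by
  obtain ⟨t, ht, h⟩ := exists_rep_mk_eq_smul hv
  have e : (t • v) ⬝ᵥ (Matrix.diagonal ![x, y, z] *ᵥ (t • v)) =
      t ^ 2 * (x * v 0 ^ 2 + y * v 1 ^ 2 + z * v 2 ^ 2) := by
    simp [Matrix.mulVec_diagonal, dotProduct, Fin.sum_univ_three]
    ring
  rw [OnConic, h, e]
  simp [ht]

theorem isPolar_mk {Q : Matrix (Fin 3) (Fin 3) ℝ} {z u : Fin 3 → ℝ} (hz : z ≠ 0) (hu : u ≠ 0)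
    {r : ℝ} (hr : r ≠ 0) (h : Q *ᵥ z = r • u) :
    IsPolar Q (Projectivization.mk ℝ z hz) (Projectivization.mk ℝ u hu) := by
  obtain ⟨t, ht, hzt⟩ := exists_rep_mk_eq_smul hz
  obtain ⟨s, hs, hus⟩ := exists_rep_mk_eq_smul hu
  refine ⟨t * r / s, by positivity, ?_⟩
  rw [hzt, hus, Matrix.mulVec_smul, h, smul_smul, smul_smul]
  congr 1
  field_simp

theorem harmonicLines_mk {l₁ l₂ n u : Fin 3 → ℝ} (h₁ : l₁ ≠ 0) (h₂ : l₂ ≠ 0) (hn : n ≠ 0)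
    (hu : u ≠ 0) (hne : Projectivization.mk ℝ n hn ≠ Projectivization.mk ℝ u hu)
    {x y r₁ r₂ : ℝ} (hr₁ : r₁ ≠ 0) (hr₂ : r₂ ≠ 0)
    (e₁ : r₁ • l₁ = x • n + y • u) (e₂ : r₂ • l₂ = x • n - y • u) :
    HarmonicLines (Projectivization.mk ℝ l₁ h₁) (Projectivization.mk ℝ l₂ h₂)
      (Projectivization.mk ℝ n hn) (Projectivization.mk ℝ u hu) := by
  obtain ⟨a, ha, ea⟩ := exists_rep_mk_eq_smul h₁
  obtain ⟨b, hb, eb⟩ := exists_rep_mk_eq_smul h₂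
  obtain ⟨c, hc, ec⟩ := exists_rep_mk_eq_smul hn
  obtain ⟨d, hd, ed⟩ := exists_rep_mk_eq_smul hu
  refine ⟨hne, a / r₁ * x / c, a / r₁ * y / d, a / r₁ * r₂ / b, by positivity, ?_, ?_⟩
  · have : l₁ = r₁⁻¹ • (x • n + y • u) := by rw [← e₁, smul_smul, inv_mul_cancel₀ hr₁, one_smul]
    rw [ea, ec, ed, this]
    ext i
    simp only [Pi.smul_apply, Pi.add_apply, smul_eq_mul]
    field_simp
  · have : l₂ = r₂⁻¹ • (x • n - y • u) := by rw [← e₂, smul_smul, inv_mul_cancel₀ hr₂, one_smul]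
    rw [eb, ec, ed, this]
    ext i
    simp only [Pi.smul_apply, Pi.sub_apply, smul_eq_mul]
    field_simp

theorem mk_eq_mk_of_smul {v w : Fin 3 → ℝ} (hv : v ≠ 0) (hw : w ≠ 0) {r s : ℝ} (hr : r ≠ 0)
    (h : r • v = s • w) : Projectivization.mk ℝ v hv = Projectivization.mk ℝ w hw := by
  refine (Projectivization.mk_eq_mk_iff' ℝ v w hv hw).2 ⟨s / r, ?_⟩
  rw [div_eq_inv_mul, mul_smul, ← h, smul_smul, inv_mul_cancel₀ hr, one_smul]

theorem adjugate_diagonal_three (x y z : ℝ) :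
    (Matrix.diagonal ![x, y, z]).adjugate = Matrix.diagonal ![y * z, x * z, x * y] := by
  ext i j
  rw [Matrix.adjugate_fin_three]
  fin_cases i <;> fin_cases j <;> simp

theorem smul_diagonal_three (r x y z : ℝ) :
    r • Matrix.diagonal ![x, y, z] = Matrix.diagonal ![r * x, r * y, r * z] := by
  ext i j
  fin_cases i <;> fin_cases j <;> simp

theorem det_diagonal_three (x y z : ℝ) : (Matrix.diagonal ![x, y, z]).det = x * y * z := by
  simp [Matrix.det_diagonal, Fin.prod_univ_three]

theorem diagonal_three_mulVec (x y z : ℝ) (v : Fin 3 → ℝ) :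
    Matrix.diagonal ![x, y, z] *ᵥ v = ![x * v 0, y * v 1, z * v 2] := by
  ext i
  fin_cases i <;> simp [Matrix.mulVec_diagonal]

theorem diagonal_mem_confocalOf {a b x y z s t r : ℝ} (hst : (s, t) ≠ (0, 0)) (hr : r ≠ 0)
    (hx : x = r * ((s * b + t) * -s)) (hy : y = r * ((s * a + t) * -s))
    (hz : z = r * ((s * a + t) * (s * b + t))) :
    Matrix.diagonal ![x, y, z] ∈ confocalOf a b := by
  refine ⟨s, t, r, hst, hr, ?_⟩
  have e : s • Matrix.diagonal ![a, b, -1] + t • Matrix.diagonal ![1, 1, 0] =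
      Matrix.diagonal ![s * a + t, s * b + t, -s] := by
    ext i j
    fin_cases i <;> fin_cases j <;> simp
  rw [e, adjugate_diagonal_three, smul_diagonal_three, hx, hy, hz]

/-! ### Tangent lines of an ellipse -/

/-- Data for the parametrization of the tangent lines of the ellipse with semi-axes `α`, `β` by
Jacobi elliptic functions. -/
structure TangentParam (α β q : ℝ) extends JacobiFunctions q where
  fst_pos : 0 < α
  snd_pos : 0 < β
  parameter_nonneg : 0 ≤ q
  parameter_mul : q * α ^ 2 = α ^ 2 - β ^ 2

namespace TangentParam

variable {α β q : ℝ} (K : TangentParam α β q)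

include K in
theorem fst_ne_zero : α ≠ 0 := K.fst_pos.ne'
include K in
theorem snd_ne_zero : β ≠ 0 := K.snd_pos.ne'

theorem addDenom_pos (u v : ℝ) : 0 < 1 - q * K.sn u ^ 2 * K.sn v ^ 2 :=
  one_sub_mul_sq_mul_sq_pos K.sq_add_sq K.dn_sq K.dn_pos u v

theorem dn_neg (u : ℝ) : K.dn (-u) = K.dn u := by
  refine (sq_eq_sq₀ (K.dn_pos _).le (K.dn_pos _).le).1 ?_
  rw [K.dn_sq, K.dn_sq, K.sn_neg, neg_sq]

theorem tangentVec_ne_zero (u : ℝ) : (![β * K.sn u, α * K.cn u, -(α * β)] : Fin 3 → ℝ) ≠ 0 := by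
  intro h
  simpa [K.fst_ne_zero, K.snd_ne_zero] using congrFun h 2

/-- The tangent line of the ellipse at the point of parameter `u`. -/
def tangentLine (u : ℝ) : Ln := Projectivization.mk ℝ _ (K.tangentVec_ne_zero u)

theorem impactVec_ne_zero (m h : ℝ) :
    (![α * (K.sn m * K.dn h), β * K.cn m, K.cn h] : Fin 3 → ℝ) ≠ 0 := by
  intro e
  have h0 : α * (K.sn m * K.dn h) = 0 := by simpa using congrFun e 0
  have h1 : β * K.cn m = 0 := by simpa using congrFun e 1
  have hs : K.sn m = 0 := by simpa [K.fst_ne_zero, (K.dn_pos h).ne'] using h0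
  have hc : K.cn m = 0 := by simpa [K.snd_ne_zero] using h1
  simpa [hs, hc] using K.sq_add_sq m

/-- The intersection of the tangent lines of parameters `m - h` and `m + h`. -/
def impact (m h : ℝ) : Pt := Projectivization.mk ℝ _ (K.impactVec_ne_zero m h)

theorem impactTangentVec_ne_zero (m h : ℝ) : (![β * (K.sn m * K.cn h),
    α * (K.cn m * K.cn h * K.dn h), -(α * β * K.dn h)] : Fin 3 → ℝ) ≠ 0 := by
  intro e
  simpa [K.fst_ne_zero, K.snd_ne_zero, (K.dn_pos h).ne'] using congrFun e 2

/-- The tangent line at `K.impact m h` of the confocal conic that passes through it. -/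
def impactTangent (m h : ℝ) : Ln := Projectivization.mk ℝ _ (K.impactTangentVec_ne_zero m h)

theorem impactNormalVec_ne_zero (m h : ℝ) : (![α * (K.cn m * K.dn h), -(β * K.sn m),
    -((α ^ 2 - β ^ 2) * (K.sn m * K.cn m * K.cn h))] : Fin 3 → ℝ) ≠ 0 := by
  intro e
  have h0 : α * (K.cn m * K.dn h) = 0 := by simpa using congrFun e 0
  have h1 : β * K.sn m = 0 := by simpa using congrFun e 1
  have hs : K.sn m = 0 := by simpa [K.snd_ne_zero] using h1
  have hc : K.cn m = 0 := by simpa [K.fst_ne_zero, (K.dn_pos h).ne'] using h0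
  simpa [hs, hc] using K.sq_add_sq m

/-- The normal line at `K.impact m h` of the confocal conic that passes through it. -/
def impactNormal (m h : ℝ) : Ln := Projectivization.mk ℝ _ (K.impactNormalVec_ne_zero m h)

/-- The confocal conic that contains the intersections of the tangent lines whose parameters differ
by `2 h`. -/
def shiftConic (h : ℝ) : Matrix (Fin 3) (Fin 3) ℝ :=
  Matrix.diagonal ![-(β ^ 2 * K.cn h ^ 2), -(α ^ 2 * K.dn h ^ 2 * K.cn h ^ 2),
    α ^ 2 * β ^ 2 * K.dn h ^ 2]

theorem sq_mul_dn_sq (h : ℝ) : α ^ 2 * K.dn h ^ 2 = β ^ 2 + (α ^ 2 - β ^ 2) * K.cn h ^ 2 := by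
  rw [K.dn_sq]
  linear_combination (-(K.sn h ^ 2)) * K.parameter_mul - (α ^ 2 - β ^ 2) * K.sq_add_sq h

theorem shiftConic_mem (c h : ℝ) : K.shiftConic h ∈ confocalOf (α ^ 2 + c) (β ^ 2 + c) := by
  have e := K.sq_mul_dn_sq h
  -- With these coefficients the dual conic is `diag(α² dn² h, β², -cn² h)`. For `cn h = 0` it gives
  -- the line at infinity.
  refine diagonal_mem_confocalOf (s := K.cn h ^ 2) (t := β ^ 2 - (β ^ 2 + c) * K.cn h ^ 2) (r := 1)
    ?_ one_ne_zero ?_ ?_ ?_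
  · intro h0
    simp only [Prod.mk.injEq] at h0
    simpa [h0.1, K.snd_ne_zero] using h0.2
  · ring
  · linear_combination (-K.cn h ^ 2) * e
  · linear_combination β ^ 2 * e

/-! ### Incidence, tangency and reflection at the impact points -/

theorem impact_neg (m h : ℝ) : K.impact m (-h) = K.impact m h := by
  simp only [impact, K.cn_neg, K.dn_neg]

theorem impact_on_tangentLine_add (m h : ℝ) : On (K.impact m h) (K.tangentLine (m + h)) := by
  rw [impact, tangentLine, on_mk_iff]
  have hD := (K.addDenom_pos m h).ne'
  have hs := K.sn_add m h
  have hc := K.cn_add m h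
  have e1 := K.sq_add_sq m
  have e3 := K.dn_sq h
  refine (mul_eq_zero.1 ?_).resolve_left hD
  simp only [Matrix.cons_val]
  linear_combination α * β * K.sn m * K.dn h * hs + α * β * K.cn m * hc +
    α * β * K.cn h * e1 + α * β * K.cn h * K.sn m ^ 2 * e3

theorem impact_on_tangentLine_sub (m h : ℝ) : On (K.impact m h) (K.tangentLine (m - h)) := by
  rw [← K.impact_neg, sub_eq_add_neg]
  exact K.impact_on_tangentLine_add m (-h)

theorem impact_onConic (m h : ℝ) : OnConic (K.shiftConic h) (K.impact m h) := by
  rw [impact, shiftConic, onConic_diagonal_mk_iff]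
  simp
  linear_combination (-(α ^ 2 * β ^ 2 * K.dn h ^ 2 * K.cn h ^ 2)) * K.sq_add_sq m

theorem tangentAt_impact (m h : ℝ) :
    TangentAt (K.shiftConic h) (K.impact m h) (K.impactTangent m h) := by
  refine ⟨K.impact_onConic m h, ?_⟩
  have hd := (K.dn_pos h).ne'
  have ha := K.fst_ne_zero
  have hb := K.snd_ne_zero
  -- If `cn h = 0`, the conic is the double line `w² = 0` and the degenerate clause of tangency
  -- applies.
  by_cases hc : K.cn h = 0
  · right
    constructor
    · obtain ⟨t, ht, e⟩ := exists_rep_mk_eq_smul (K.impactVec_ne_zero m h)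
      rw [impact, e, shiftConic, diagonal_three_mulVec]
      simp [hc]
    · intro y
      induction y using Projectivization.ind with
      | h v hv =>
        rw [shiftConic, impactTangent, onConic_diagonal_mk_iff, on_mk_iff]
        simp [hc, hd, ha, hb]
  · left
    refine isPolar_mk _ _ (r := -(α * β * K.cn h * K.dn h)) (by simp [*]) ?_
    rw [shiftConic, diagonal_three_mulVec]
    ext i
    fin_cases i <;> simp <;> ring

/-- `N D L(m ± h) = E± (A dn m T ± αβ sn h n)` in homogeneous coordinates. -/
theorem smul_tangentVec_add (m h : ℝ) :
    ((α ^ 2 * K.cn m ^ 2 * K.dn h ^ 2 + β ^ 2 * K.sn m ^ 2) *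
      (1 - q * K.sn m ^ 2 * K.sn h ^ 2)) •
        (![β * K.sn (m + h), α * K.cn (m + h), -(α * β)] : Fin 3 → ℝ) =
    (K.dn h * K.dn m - q * K.sn m * K.cn m * K.sn h * K.cn h) •
      ((α * β * K.sn h) • ![α * (K.cn m * K.dn h), -(β * K.sn m),
          -((α ^ 2 - β ^ 2) * (K.sn m * K.cn m * K.cn h))] +
        (α ^ 2 * K.dn m) • ![β * (K.sn m * K.cn h), α * (K.cn m * K.cn h * K.dn h),
          -(α * β * K.dn h)]) := by
  have hs := K.sn_add m h
  have hc := K.cn_add m h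
  have e1 : K.cn m ^ 2 = 1 - K.sn m ^ 2 := by linarith [K.sq_add_sq m]
  have e2 : K.cn h ^ 2 = 1 - K.sn h ^ 2 := by linarith [K.sq_add_sq h]
  have e3 := K.dn_sq h
  have e4 := K.dn_sq m
  have e5 : β ^ 2 = α ^ 2 - q * α ^ 2 := by linarith [K.parameter_mul]
  set N := α ^ 2 * K.cn m ^ 2 * K.dn h ^ 2 + β ^ 2 * K.sn m ^ 2 with hN
  -- Each shape of `N` matches one term of an addition formula. `N5` says that `N D` is `α²` times
  -- the product of the two factors `E+` and `E-`.
  have N1 : N = α ^ 2 * (K.dn h ^ 2 - q * K.sn m ^ 2 * K.cn h ^ 2) := by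
    simp only [hN, e1, e2, e3, e5]; ring
  have N2 : N = α ^ 2 * (K.dn m ^ 2 - q * K.sn h ^ 2 * K.cn m ^ 2) := by
    simp only [hN, e1, e3, e4, e5]; ring
  have N3 : N = α ^ 2 * K.dn m ^ 2 * K.dn h ^ 2 + q * β ^ 2 * K.sn m ^ 2 * K.sn h ^ 2 := by
    simp only [hN, e1, e3, e4, e5]; ring
  have N4 : N = β ^ 2 + q * α ^ 2 * K.cn m ^ 2 * K.cn h ^ 2 := by
    simp only [hN, e1, e2, e3, e5]; ring
  have N5 : N * (1 - q * K.sn m ^ 2 * K.sn h ^ 2) = α ^ 2 * (K.dn m ^ 2 * K.dn h ^ 2 -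
      q ^ 2 * K.sn m ^ 2 * K.cn m ^ 2 * K.sn h ^ 2 * K.cn h ^ 2) := by
    simp only [hN, e1, e2, e3, e4, e5]; ring
  clear_value N
  ext i
  fin_cases i
  · simp
    linear_combination β * N * hs + β * (K.sn m * K.cn h * K.dn h) * N2 +
      β * (K.sn h * K.cn m * K.dn m) * N1
  · simp
    linear_combination α * N * hc + α * (K.cn m * K.cn h) * N3 -
      α * (K.sn h * K.sn m * K.dn m * K.dn h) * N4
  · simp
    linear_combination -(α * β) * N5 + (K.dn h * K.dn m - q * K.sn m * K.cn m * K.sn h * K.cn h) *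
      α * β * K.sn m * K.cn m * K.sn h * K.cn h * -e5

/-- The factor is the numerator of the addition formula for `dn`. Its square equals that of `D dn (m
+ h)`, with `D` the common denominator, and this is positive; the sign is not needed. -/
theorem reflectionFactor_ne_zero (m h : ℝ) :
    K.dn h * K.dn m - q * K.sn m * K.cn m * K.sn h * K.cn h ≠ 0 := by
  intro e
  have hs := K.sn_add m h
  have e1 : K.cn m ^ 2 = 1 - K.sn m ^ 2 := by linarith [K.sq_add_sq m]
  have e2 : K.cn h ^ 2 = 1 - K.sn h ^ 2 := by linarith [K.sq_add_sq h]
  have e3 := K.dn_sq h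
  have e4 := K.dn_sq m
  have e5 := K.dn_sq (m + h)
  have hD := K.addDenom_pos m h
  have e6 : K.dn m ^ 2 * K.dn h ^ 2 +
      q ^ 2 * K.sn m ^ 2 * K.cn m ^ 2 * K.sn h ^ 2 * K.cn h ^ 2 +
      q * (K.sn m ^ 2 * K.cn h ^ 2 * K.dn h ^ 2 + K.sn h ^ 2 * K.cn m ^ 2 * K.dn m ^ 2) =
      (1 - q * K.sn m ^ 2 * K.sn h ^ 2) ^ 2 := by
    simp only [e1, e2, e3, e4]; ring
  have : (K.dn h * K.dn m - q * K.sn m * K.cn m * K.sn h * K.cn h) ^ 2 =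
      ((1 - q * K.sn m ^ 2 * K.sn h ^ 2) * K.dn (m + h)) ^ 2 := by
    rw [mul_pow, e5, mul_sub, mul_left_comm, ← mul_pow, hs]
    linear_combination e6
  rw [e, zero_pow two_ne_zero] at this
  exact (pow_pos (mul_pos hD (K.dn_pos (m + h))) 2).ne this

theorem normalWeight_pos (m h : ℝ) :
    0 < α ^ 2 * K.cn m ^ 2 * K.dn h ^ 2 + β ^ 2 * K.sn m ^ 2 := by
  have ha := K.fst_pos
  have hb := K.snd_pos
  have hd := K.dn_pos h
  by_cases h0 : K.cn m = 0
  · have : K.sn m ^ 2 = 1 := by simpa [h0] using K.sq_add_sq m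
    rw [this, h0]; positivity
  · positivity

theorem impactNormal_ne_impactTangent (m h : ℝ) : K.impactNormal m h ≠ K.impactTangent m h := by
  intro e
  obtain ⟨a, ha⟩ := (Projectivization.mk_eq_mk_iff' ..).1 e
  have h0 := congrFun ha 0
  have h1 := congrFun ha 1
  simp at h0 h1
  refine (K.normalWeight_pos m h).ne' ?_
  linear_combination (-(α * K.cn m * K.dn h)) * h0 + β * K.sn m * h1

/-- In the expansion `smul_tangentVec_add` along normal and tangent, replacing `h` by `-h` changes,
up to an overall factor, only the sign of the normal coefficient. -/
theorem harmonicLines_impact (m h : ℝ) : HarmonicLines (K.tangentLine (m - h))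
    (K.tangentLine (m + h)) (K.impactNormal m h) (K.impactTangent m h) := by
  have hN := (K.normalWeight_pos m h).ne'
  have hD := (K.addDenom_pos m h).ne'
  have hp := K.reflectionFactor_ne_zero m h
  have hm := K.reflectionFactor_ne_zero m (-h)
  have ep := K.smul_tangentVec_add m h
  have em := K.smul_tangentVec_add m (-h)
  simp only [K.sn_neg, K.cn_neg, K.dn_neg, neg_sq, ← sub_eq_add_neg] at hm em
  -- The harmonic form flips the tangent coefficient instead of the normal one, hence the extra
  -- minus sign in the second scalar.
  refine harmonicLines_mk _ _ _ _ (K.impactNormal_ne_impactTangent m h)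
    (x := α * β * -K.sn h) (y := α ^ 2 * K.dn m)
    (mul_ne_zero (inv_ne_zero hm) (mul_ne_zero hN hD))
    (mul_ne_zero (neg_ne_zero.2 (inv_ne_zero hp)) (mul_ne_zero hN hD)) ?_ ?_
  · rw [mul_smul, em, smul_smul, inv_mul_cancel₀ hm, one_smul]
  · rw [mul_smul, ep, smul_smul, neg_mul, inv_mul_cancel₀ hp, neg_smul, one_smul]
    module

/-- Consecutive tangent lines `m - h`, `m + h` obey the reflection law where they meet. -/
theorem reflectionLaw_impact (c m h : ℝ) :
    ReflectionLaw (confocalOf (α ^ 2 + c) (β ^ 2 + c)) (K.shiftConic h) (K.impact m h)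
      (K.tangentLine (m - h)) (K.tangentLine (m + h)) := by
  refine ⟨K.impact_on_tangentLine_sub m h, K.impact_on_tangentLine_add m h,
    K.impactTangent m h, K.tangentAt_impact m h, ?_⟩
  have ha := K.fst_pos
  have hb := K.snd_pos
  have hd := K.dn_pos h
  have hw := K.sq_mul_dn_sq h
  have hq : 0 < α ^ 2 - β ^ 2 / 2 := by
    nlinarith [K.parameter_mul, mul_nonneg K.parameter_nonneg (sq_nonneg α), pow_pos hb 2]
  have hz : (![(α ^ 2 - β ^ 2 / 2) * (β * (K.sn m * K.cn h)),
      β ^ 2 / 2 * (α * (K.cn m * K.cn h * K.dn h)), α * β * K.dn h] : Fin 3 → ℝ) ≠ 0 := by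
    intro e
    simpa [ha.ne', hb.ne', hd.ne'] using congrFun e 2
  -- The auxiliary conic is the confocal ellipse with squared semi-axes `α² - β²/2` and `β²/2`. It
  -- lies inside the caustic, so it is never `shiftConic h`, and the pole differs from the impact
  -- point. The pole `z` is the dual matrix applied to the tangent.
  refine ⟨Matrix.diagonal ![-(β ^ 2 / 2), -(α ^ 2 - β ^ 2 / 2), (α ^ 2 - β ^ 2 / 2) * (β ^ 2 / 2)],
    diagonal_mem_confocalOf (s := 1) (t := -c - β ^ 2 / 2) (r := 1) (by simp) one_ne_zero
      (by ring) (by ring) (by ring), ?_,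
    Projectivization.mk ℝ _ hz, isPolar_mk _ _ (r := -((α ^ 2 - β ^ 2 / 2) * (β ^ 2 / 2)))
      (neg_ne_zero.2 (by positivity)) ?_, fun e => ?_, K.impactNormal m h, ?_, ?_,
    K.harmonicLines_impact m h⟩
  · rw [det_diagonal_three]
    simp only [neg_mul_neg]
    positivity
  · rw [diagonal_three_mulVec]
    ext i
    fin_cases i <;> simp <;> ring
  · obtain ⟨a, e⟩ := (Projectivization.mk_eq_mk_iff' ..).1 e
    have h0 := congrFun e 0
    have h1 := congrFun e 1
    have h2 := congrFun e 2
    simp at h0 h1 h2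
    have hk : 0 < 1 - K.cn h ^ 2 / 2 := by nlinarith [K.sq_add_sq h, sq_nonneg (K.sn h)]
    have hs : K.sn m = 0 := by
      have : K.sn m * (β ^ 3 * (1 - K.cn h ^ 2 / 2)) = 0 := by
        linear_combination K.cn h * h0 - α * K.sn m * K.dn h * h2 - K.sn m * β * hw
      exact (mul_eq_zero.1 this).resolve_right (by positivity)
    have hc : K.cn m = 0 := by
      have : K.cn m * (α * β ^ 2 * K.dn h * (1 - K.cn h ^ 2 / 2)) = 0 := by
        linear_combination K.cn h * h1 - β * K.cn m * h2
      exact (mul_eq_zero.1 this).resolve_right (by positivity)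
    simpa [hs, hc] using K.sq_add_sq m
  · rw [impact, impactNormal, on_mk_iff]
    simp only [Matrix.cons_val]
    linear_combination K.sn m * K.cn m * hw
  · rw [impactNormal, on_mk_iff]
    simp only [Matrix.cons_val]
    ring

/-- On the tangent line `g`, `w` is the homogeneous coordinate and `r` measures displacement along
the line from the point of contact. In these coordinates the impact point has `(w : r) = (D cn h :
W)`, and `hF` is the resulting proportionality. -/
theorem mk_eq_impact {g h w r : ℝ} {v : Fin 3 → ℝ} (hv : v ≠ 0)
    (h0 : v 0 = α * (w * K.sn g + r * K.cn g)) (h1 : v 1 = β * (w * K.cn g - r * K.sn g))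
    (h2 : v 2 = w)
    (hF : (1 - q * K.sn g ^ 2 * K.sn h ^ 2) * r * K.cn h =
      w * (K.sn h * (K.dn h * K.dn g - q * K.sn g * K.cn g * K.sn h * K.cn h))) :
    Projectivization.mk ℝ v hv = K.impact (g + h) h := by
  have hD := (K.addDenom_pos g h).ne'
  have hE := K.reflectionFactor_ne_zero g h
  have hs := K.sn_add g h
  have hc := K.cn_add g h
  have e1 : K.cn g ^ 2 = 1 - K.sn g ^ 2 := by linarith [K.sq_add_sq g]
  have e3 := K.dn_sq h
  set D := 1 - q * K.sn g ^ 2 * K.sn h ^ 2 with hDdef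
  set W := K.sn h * (K.dn h * K.dn g - q * K.sn g * K.cn g * K.sn h * K.cn h) with hW
  have x0 : D * (K.sn (g + h) * K.dn h) = D * K.cn h * K.sn g + W * K.cn g := by
    rw [hW, ← mul_assoc, hs, hDdef]
    linear_combination K.sn g * K.cn h * e3 + q * K.sn g * K.sn h ^ 2 * K.cn h * e1
  have x1 : D * K.cn (g + h) = D * K.cn h * K.cn g - W * K.sn g := by
    rw [hW, hc, hDdef]
    ring
  -- The scale must be nonzero: `W` serves when the impact point is at infinity, `D cn h` otherwise.
  by_cases hh : K.cn h = 0
  · have hW0 : W ≠ 0 := by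
      refine mul_ne_zero (fun h3 => ?_) hE
      simpa [hh, h3] using K.sq_add_sq h
    refine mk_eq_mk_of_smul hv (K.impactVec_ne_zero _ _) (s := D * r) hW0 ?_
    ext i
    fin_cases i
    · simp [h0]
      linear_combination -(α * K.sn g) * hF - α * r * x0
    · simp [h1]
      linear_combination -(β * K.cn g) * hF - β * r * x1
    · simp [h2]
      linear_combination -hF
  · refine mk_eq_mk_of_smul hv (K.impactVec_ne_zero _ _) (r := D * K.cn h) (s := D * w)
      (mul_ne_zero hD hh) ?_
    ext i
    fin_cases i
    · simp [h0]
      linear_combination α * K.cn g * hF - α * w * x0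
    · simp [h1]
      linear_combination -(β * K.sn g) * hF - β * w * x1
    · simp [h2]
      ring

/-- A tangent line meets a confocal conic in the two points where it meets the tangent lines
obtained by the shift that belongs to this conic. -/
theorem tangentLine_inter_shiftConic (g h : ℝ) :
    {y : Pt | On y (K.tangentLine g) ∧ OnConic (K.shiftConic h) y} =
      {K.impact (g - h) h, K.impact (g + h) h} := by
  ext y
  simp only [Set.mem_ofPred_eq, Set.mem_insert_iff, Set.mem_singleton_iff]
  constructor
  · induction y using Projectivization.ind with
    | h v hv =>
    rw [tangentLine, shiftConic, on_mk_iff, onConic_diagonal_mk_iff]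
    rintro ⟨hl, hQ⟩
    simp only [Matrix.cons_val] at hl
    have ha := K.fst_ne_zero
    have hb := K.snd_ne_zero
    have e1 : K.cn g ^ 2 = 1 - K.sn g ^ 2 := by linarith [K.sq_add_sq g]
    have e2 : K.cn h ^ 2 = 1 - K.sn h ^ 2 := by linarith [K.sq_add_sq h]
    have e3 := K.dn_sq h
    have e4 := K.dn_sq g
    obtain ⟨w, hw⟩ : ∃ w, v 2 = w := ⟨_, rfl⟩
    obtain ⟨r, hr⟩ : ∃ r, β * K.cn g * v 0 - α * K.sn g * v 1 = α * β * r :=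
      ⟨(β * K.cn g * v 0 - α * K.sn g * v 1) / (α * β), by field_simp⟩
    rw [hw] at hl
    have h0 : v 0 = α * (w * K.sn g + r * K.cn g) := by
      refine mul_left_cancel₀ hb ?_
      linear_combination K.sn g * hl + K.cn g * hr - β * v 0 * K.sq_add_sq g
    have h1 : v 1 = β * (w * K.cn g - r * K.sn g) := by
      refine mul_left_cancel₀ ha ?_
      linear_combination K.cn g * hl - K.sn g * hr - α * v 1 * K.sq_add_sq g
    have hf : K.cn h ^ 2 * (w * K.sn g + r * K.cn g) ^ 2 +
        K.dn h ^ 2 * K.cn h ^ 2 * (w * K.cn g - r * K.sn g) ^ 2 - K.dn h ^ 2 * w ^ 2 = 0 := by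
      refine mul_left_cancel₀ (mul_ne_zero (pow_ne_zero 2 ha) (pow_ne_zero 2 hb)) ?_
      rw [h0, h1, hw] at hQ
      linear_combination -hQ
    -- Multiplied by `D`, the quadratic form of the conic restricted to the line splits into two
    -- linear factors, one for each sign of `h`.
    have hprod : ((1 - q * K.sn g ^ 2 * K.sn h ^ 2) * r * K.cn h + w * (K.sn h *
          (K.dn h * K.dn g + q * K.sn g * K.cn g * K.sn h * K.cn h))) *
        ((1 - q * K.sn g ^ 2 * K.sn h ^ 2) * r * K.cn h - w * (K.sn h *
          (K.dn h * K.dn g - q * K.sn g * K.cn g * K.sn h * K.cn h))) = 0 := by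
      have c1 : K.cn g ^ 2 + K.dn h ^ 2 * K.sn g ^ 2 = 1 - q * K.sn g ^ 2 * K.sn h ^ 2 := by
        simp only [e1, e3]; ring
      have c2 : 1 - K.dn h ^ 2 = q * K.sn h ^ 2 := by
        simp only [e3]; ring
      have c3 : (1 - q * K.sn g ^ 2 * K.sn h ^ 2) * (K.cn h ^ 2 * K.sn g ^ 2 +
          K.dn h ^ 2 * K.cn h ^ 2 * K.cn g ^ 2 - K.dn h ^ 2) =
          -(K.sn h ^ 2 * (K.dn h ^ 2 * K.dn g ^ 2 -
            q ^ 2 * K.sn g ^ 2 * K.cn g ^ 2 * K.sn h ^ 2 * K.cn h ^ 2)) := by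
        simp only [e1, e2, e3, e4]; ring
      linear_combination (1 - q * K.sn g ^ 2 * K.sn h ^ 2) * (hf - r ^ 2 * K.cn h ^ 2 * c1 -
        2 * w * r * K.sn g * K.cn g * K.cn h ^ 2 * c2) - w ^ 2 * c3
    rcases mul_eq_zero.1 hprod with hF | hF
    · left
      rw [sub_eq_add_neg, ← K.impact_neg]
      refine K.mk_eq_impact hv h0 h1 hw ?_
      simp only [K.sn_neg, K.cn_neg, K.dn_neg]
      linear_combination hF
    · exact Or.inr (K.mk_eq_impact hv h0 h1 hw (by linear_combination hF))
  · rintro (rfl | rfl)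
    · exact ⟨by simpa using K.impact_on_tangentLine_add (g - h) h, K.impact_onConic _ _⟩
    · exact ⟨by simpa using K.impact_on_tangentLine_sub (g + h) h, K.impact_onConic _ _⟩

theorem isBilliardTrajectory_tangentLine (c g h : ℝ) :
    IsBilliardTrajectory (confocalOf (α ^ 2 + c) (β ^ 2 + c)) (K.shiftConic h)
      fun i : ℤ => K.tangentLine (g + i * (2 * h)) := by
  -- The offset `-h` puts the `i`-th impact midway in parameter between lines `i - 1` and `i`.
  refine ⟨fun i => K.impact (g + i * (2 * h) - h) h, fun i => ⟨?_, ?_⟩⟩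
  · have := K.reflectionLaw_impact c (g + i * (2 * h) - h) h
    convert this using 2 <;> push_cast <;> ring
  · rw [K.tangentLine_inter_shiftConic]
    congr 3
    push_cast
    ring

/-! ### Double reflection quadrilaterals -/

theorem pencilVec_ne_zero (M h h' : ℝ) : (![α * (K.sn M * (K.dn h * K.dn h')), β * K.cn M,
    K.cn h * K.cn h'] : Fin 3 → ℝ) ≠ 0 := by
  intro e
  have h0 : α * (K.sn M * (K.dn h * K.dn h')) = 0 := by simpa using congrFun e 0
  have h1 : β * K.cn M = 0 := by simpa using congrFun e 1
  have hs : K.sn M = 0 := by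
    simpa [K.fst_ne_zero, (K.dn_pos h).ne', (K.dn_pos h').ne'] using h0
  have hc : K.cn M = 0 := by simpa [K.snd_ne_zero] using h1
  simpa [hs, hc] using K.sq_add_sq M

/-- The common point of the tangent lines at the vertices of a double reflection quadrilateral. -/
def pencilPoint (M h h' : ℝ) : Pt := Projectivization.mk ℝ _ (K.pencilVec_ne_zero M h h')

/-- This is the incidence identity of `impact_on_tangentLine_add` for `M`, `h'`, multiplied by `cn h
dn h`. As the point is even in `h'` and symmetric in `h`, `h'`, the other three incidences follow.
-/
theorem pencilPoint_on_add (M h h' : ℝ) :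
    On (K.pencilPoint M h h') (K.impactTangent (M + h') h) := by
  rw [pencilPoint, impactTangent, on_mk_iff]
  have hs := K.sn_add M h'
  have hc := K.cn_add M h'
  have e1 := K.sq_add_sq M
  have e3 := K.dn_sq h'
  refine (mul_eq_zero.1 ?_).resolve_left (K.addDenom_pos M h').ne'
  simp only [Matrix.cons_val]
  linear_combination α * β * K.cn h * K.dn h * (K.sn M * K.dn h' * hs + K.cn M * hc +
    K.cn h' * e1 + K.cn h' * K.sn M ^ 2 * e3)

theorem pencilPoint_on_sub (M h h' : ℝ) :
    On (K.pencilPoint M h h') (K.impactTangent (M - h') h) := by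
  have := K.pencilPoint_on_add M h (-h')
  simpa only [pencilPoint, K.cn_neg, K.dn_neg, ← sub_eq_add_neg] using this

theorem pencilPoint_comm (M h h' : ℝ) : K.pencilPoint M h h' = K.pencilPoint M h' h := by
  simp only [pencilPoint, mul_comm]

theorem isDoubleReflectionConfiguration_tangentLine (c g h h' : ℝ) :
    IsDoubleReflectionConfiguration (confocalOf (α ^ 2 + c) (β ^ 2 + c))
      (K.shiftConic h) (K.shiftConic h') (K.tangentLine g) (K.tangentLine (g + 2 * h))
      (K.tangentLine (g + 2 * h')) (K.tangentLine (g + 2 * h + 2 * h')) := by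
  -- Centring at the mean parameter makes the four lines `M ± h ± h'`.
  obtain ⟨M, rfl⟩ : ∃ M, g = M - h - h' := ⟨g + h + h', by ring⟩
  refine ⟨K.impact (M - h') h, K.impact (M + h') h, K.impact (M - h) h', K.impact (M + h) h',
    ?_, ?_, ?_, ?_, _, _, _, _, K.tangentAt_impact _ _, K.tangentAt_impact _ _,
    K.tangentAt_impact _ _, K.tangentAt_impact _ _, K.pencilPoint M h h',
    K.pencilPoint_on_sub _ _ _, K.pencilPoint_on_add _ _ _, ?_, ?_⟩
  · convert K.reflectionLaw_impact c (M - h') h using 2 <;> ring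
  · convert K.reflectionLaw_impact c (M + h') h using 2 <;> ring
  · convert K.reflectionLaw_impact c (M - h) h' using 2 
    ring
  · convert K.reflectionLaw_impact c (M + h) h' using 2 <;> ring
  · rw [pencilPoint_comm]; exact K.pencilPoint_on_sub _ _ _
  · rw [pencilPoint_comm]; exact K.pencilPoint_on_add _ _ _

end TangentParam

/-! ### The Euclidean billiard -/

theorem affinePt_injective : Function.Injective affinePt := by
  intro p p' e
  obtain ⟨r, e⟩ := (Projectivization.mk_eq_mk_iff' ..).1 e
  have h0 := congrFun e 0
  have h1 := congrFun e 1
  have h2 := congrFun e 2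
  simp at h0 h1 h2
  ext i
  fin_cases i
  · simp [← h0, h2]
  · simp [← h1, h2]

theorem line_eq_of_affinePt_on {p p' : EuclideanSpace ℝ (Fin 2)} (hne : p ≠ p') {l l' : Ln}
    (hp : On (affinePt p) l) (hp' : On (affinePt p') l) (hq : On (affinePt p) l')
    (hq' : On (affinePt p') l') : l = l' := by
  induction l using Projectivization.ind with
  | h v hv =>
  induction l' using Projectivization.ind with
  | h w hw =>
  rw [affinePt, on_mk_iff] at hp hp' hq hq'
  simp at hp hp' hq hq'
  have hc : v 0 * w 1 = v 1 * w 0 := by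
    by_contra hc
    apply hne
    have h0 : (v 0 * w 1 - v 1 * w 0) * (p 0 - p' 0) = 0 := by
      linear_combination w 1 * hp - w 1 * hp' - v 1 * hq + v 1 * hq'
    have h1 : (v 0 * w 1 - v 1 * w 0) * (p 1 - p' 1) = 0 := by
      linear_combination v 0 * hq - v 0 * hq' - w 0 * hp + w 0 * hp'
    have h0 := (mul_eq_zero.1 h0).resolve_left (sub_ne_zero.2 hc)
    have h1 := (mul_eq_zero.1 h1).resolve_left (sub_ne_zero.2 hc)
    ext i
    fin_cases i
    · exact sub_eq_zero.1 h0
    · exact sub_eq_zero.1 h1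
  by_cases h0 : w 0 = 0
  · have h1 : w 1 ≠ 0 := by
      intro h1
      apply hw
      ext i
      fin_cases i <;> simp [h0, h1] at hq ⊢
      exact hq
    refine mk_eq_mk_of_smul hv hw (s := v 1) h1 ?_
    ext i
    fin_cases i
    · simp; linear_combination hc
    · simp; ring
    · simp; linear_combination w 1 * hp - v 1 * hq - p 0 * hc
  · refine mk_eq_mk_of_smul hv hw (s := v 0) h0 ?_
    ext i
    fin_cases i
    · simp; ring
    · simp; linear_combination -hc
    · simp; linear_combination w 0 * hp - v 0 * hq + p 1 * hc

theorem dir_comm (p p' : EuclideanSpace ℝ (Fin 2)) : dir p p' = -dir p' p := by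
  rw [dir, dir, norm_sub_rev, ← smul_neg, neg_sub]

theorem sq_mul_reflection_apply (n v : EuclideanSpace ℝ (Fin 2)) (hn : n 0 ^ 2 + n 1 ^ 2 ≠ 0)
    (i : Fin 2) : (n 0 ^ 2 + n 1 ^ 2) * (Submodule.span ℝ {n})ᗮ.reflection v i =
      (n 0 ^ 2 + n 1 ^ 2) * v i - 2 * (n 0 * v 0 + n 1 * v 1) * n i := by
  have hnorm : ‖n‖ ^ 2 = n 0 ^ 2 + n 1 ^ 2 := by
    simp [EuclideanSpace.norm_sq_eq, Fin.sum_univ_two]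
  have hinner : inner ℝ n v = n 0 * v 0 + n 1 * v 1 := by
    simp [PiLp.inner_apply, Fin.sum_univ_two]; ring
  rw [Submodule.reflection_orthogonal_apply, Submodule.reflection_singleton_apply]
  simp [hnorm, hinner]
  field_simp

/-! ### Euclidean reflection as a shift of the parameter -/

namespace TangentParam

variable {α β q : ℝ} (K : TangentParam α β q)

theorem touches_tangentLine (g : ℝ) : Touches (K.tangentLine g) (axisConic (α ^ 2) (β ^ 2)) := by
  have ha := K.fst_ne_zero
  have hb := K.snd_ne_zero
  have hv : (![α * K.sn g, β * K.cn g, 1] : Fin 3 → ℝ) ≠ 0 := fun e => by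
    simpa using congrFun e 2
  refine ⟨Projectivization.mk ℝ _ hv, ?_, Or.inl (isPolar_mk _ _ (r := (α * β)⁻¹) (by simp [*]) ?_)⟩
  · rw [axisConic, onConic_diagonal_mk_iff]
    simp
    field_simp
    linear_combination K.sq_add_sq g
  · rw [axisConic, diagonal_three_mulVec]
    ext i
    fin_cases i <;> simp <;> field_simp

theorem exists_eq_tangentLine {l : Ln} (hl : Touches l (axisConic (α ^ 2) (β ^ 2))) :
    ∃ g, l = K.tangentLine g := by
  have ha := K.fst_ne_zero
  have hb := K.snd_ne_zero
  obtain ⟨x, hx, hu⟩ := hl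
  have hv := x.rep_nonzero
  rw [← x.mk_rep, axisConic, onConic_diagonal_mk_iff] at hx
  rw [axisConic] at hu
  unfold IsPolar at hu
  rw [diagonal_three_mulVec] at hu
  generalize x.rep = v at *
  have h2 : v 2 ≠ 0 := by
    intro h2
    have e : v 0 ^ 2 / α ^ 2 + v 1 ^ 2 / β ^ 2 = 0 := by
      rw [h2] at hx; linear_combination hx
    have p0 : 0 ≤ v 0 ^ 2 / α ^ 2 := by positivity
    have p1 : 0 ≤ v 1 ^ 2 / β ^ 2 := by positivity
    have e0 : v 0 ^ 2 / α ^ 2 = 0 := by linarith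
    have e1 : v 1 ^ 2 / β ^ 2 = 0 := by linarith
    simp [ha, hb] at e0 e1
    apply hv
    ext i
    fin_cases i <;> simp [*]
  rcases hu with ⟨r, hr, e⟩ | ⟨e, -⟩
  · obtain ⟨g, hs, hc⟩ := K.surj (v 0 / (α * v 2)) (v 1 / (β * v 2)) (by
      field_simp
      field_simp at hx
      linear_combination hx)
    refine ⟨g, ?_⟩
    rw [← l.mk_rep, tangentLine]
    refine mk_eq_mk_of_smul l.rep_nonzero _ (s := v 2 / (α * β)) hr ?_
    rw [← e, hs, hc]
    ext i
    fin_cases i <;> simp <;> field_simp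
  · have := congrFun e 2
    simp at this
    exact absurd this h2

theorem coord_eq_of_affinePt_eq {p : EuclideanSpace ℝ (Fin 2)} {m h : ℝ}
    (hp : affinePt p = K.impact m h) :
    p 0 * K.cn h = α * (K.sn m * K.dn h) ∧ p 1 * K.cn h = β * K.cn m := by
  obtain ⟨r, e⟩ := (Projectivization.mk_eq_mk_iff' ..).1 hp
  have h0 := congrFun e 0
  have h1 := congrFun e 1
  have h2 := congrFun e 2
  simp at h0 h1 h2
  constructor
  · linear_combination -K.cn h * h0 + α * (K.sn m * K.dn h) * h2
  · linear_combination -K.cn h * h1 + β * K.cn m * h2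

/-- The reflection in the ellipse exchanges the directions of the two tangent lines of the
caustic. -/
theorem reflection_perp {a b m h : ℝ} (hc : K.cn h ≠ 0) (hE : a * K.cn h ^ 2 = α ^ 2 * K.dn h ^ 2)
    (hE' : b * K.cn h ^ 2 = β ^ 2) {p v : EuclideanSpace ℝ (Fin 2)}
    (hp : affinePt p = K.impact m h)
    (hv : β * K.sn (m - h) * v 0 + α * K.cn (m - h) * v 1 = 0) :
    β * K.sn (m + h) * (Submodule.span ℝ {ellipseNormal a b p})ᗮ.reflection v 0 +
      α * K.cn (m + h) * (Submodule.span ℝ {ellipseNormal a b p})ᗮ.reflection v 1 = 0 := by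
  have ha := K.fst_ne_zero
  have hb := K.snd_ne_zero
  have hd := (K.dn_pos h).ne'
  obtain ⟨hp0, hp1⟩ := K.coord_eq_of_affinePt_eq hp
  have ha' : a ≠ 0 := by rintro rfl; simp [ha, hd] at hE
  have hb' : b ≠ 0 := by
    rintro rfl
    exact pow_ne_zero 2 hb (by simpa using hE'.symm)
  set n := ellipseNormal a b p with hn
  have n0 : α * K.dn h * n 0 = K.sn m * K.cn h := by
    have : n 0 * a = p 0 := by simp [hn, ellipseNormal, ha']
    refine mul_left_cancel₀ (mul_ne_zero ha hd) ?_
    linear_combination K.cn h * hp0 - n 0 * hE + K.cn h ^ 2 * this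
  have n1 : β * n 1 = K.cn m * K.cn h := by
    have : n 1 * b = p 1 := by simp [hn, ellipseNormal, hb']
    refine mul_left_cancel₀ hb ?_
    linear_combination K.cn h * hp1 - n 1 * hE' + K.cn h ^ 2 * this
  have hnn : n 0 ^ 2 + n 1 ^ 2 ≠ 0 := by
    intro e
    have e0 : n 0 = 0 := by nlinarith [sq_nonneg (n 0), sq_nonneg (n 1)]
    have e1 : n 1 = 0 := by nlinarith [sq_nonneg (n 0), sq_nonneg (n 1)]
    rw [e0, mul_zero, eq_comm, mul_eq_zero] at n0
    rw [e1, mul_zero, eq_comm, mul_eq_zero] at n1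
    simpa [n0.resolve_right hc, n1.resolve_right hc] using K.sq_add_sq m
  have w0 := sq_mul_reflection_apply n v hnn 0
  have w1 := sq_mul_reflection_apply n v hnn 1
  set w := (Submodule.span ℝ {n})ᗮ.reflection v
  have hm := K.reflectionFactor_ne_zero m (-h)
  have ep := K.smul_tangentVec_add m h
  have em := K.smul_tangentVec_add m (-h)
  simp only [K.sn_neg, K.cn_neg, K.dn_neg, neg_sq, ← sub_eq_add_neg] at hm em
  have ep0 := congrFun ep 0
  have ep1 := congrFun ep 1
  have em0 := congrFun em 0
  have em1 := congrFun em 1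
  simp only [Pi.smul_apply, Pi.add_apply, smul_eq_mul, Matrix.cons_val] at ep0 ep1 em0 em1
  set N := α ^ 2 * K.cn m ^ 2 * K.dn h ^ 2 + β ^ 2 * K.sn m ^ 2
  set D := 1 - q * K.sn m ^ 2 * K.sn h ^ 2
  have hND : N * D ≠ 0 := mul_ne_zero (K.normalWeight_pos m h).ne' (K.addDenom_pos m h).ne'
  have t0 : β * (K.sn m * K.cn h) = α * β * K.dn h * n 0 := by linear_combination -β * n0
  have t1 : α * (K.cn m * K.cn h * K.dn h) = α * β * K.dn h * n 1 := by
    linear_combination -α * K.dn h * n1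
  rw [t0] at ep0 em0
  rw [t1] at ep1 em1
  -- The affine part `k` of the normal line's covector is orthogonal to `n`, so the reflection fixes
  -- `k` and negates `n`. It thus carries the covector of line `m - h` to a multiple of that of `m +
  -- h`, and preserves orthogonality to `v`.
  have hperp : n 0 * (α * (K.cn m * K.dn h)) + n 1 * -(β * K.sn m) = 0 := by
    linear_combination K.cn m * n0 - K.sn m * n1
  generalize α * (K.cn m * K.dn h) = k0 at *
  generalize -(β * K.sn m) = k1 at *
  have key : (α * β * -K.sn h * k0 + α ^ 2 * K.dn m * (α * β * K.dn h * n 0)) * v 0 +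
      (α * β * -K.sn h * k1 + α ^ 2 * K.dn m * (α * β * K.dn h * n 1)) * v 1 = 0 := by
    refine mul_left_cancel₀ hm ?_
    linear_combination N * D * hv - v 0 * em0 - v 1 * em1
  refine mul_left_cancel₀ (mul_ne_zero hnn hND) ?_
  linear_combination (n 0 ^ 2 + n 1 ^ 2) * w 0 * ep0 + (n 0 ^ 2 + n 1 ^ 2) * w 1 * ep1 +
    (K.dn h * K.dn m - q * K.sn m * K.cn m * K.sn h * K.cn h) *
      ((α * β * K.sn h * k0 + α ^ 2 * K.dn m * (α * β * K.dn h * n 0)) * w0 +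
        (α * β * K.sn h * k1 + α ^ 2 * K.dn m * (α * β * K.dn h * n 1)) * w1 -
        (n 0 ^ 2 + n 1 ^ 2) * key -
        2 * (n 0 * v 0 + n 1 * v 1) * (α * β * K.sn h) * hperp)

/-- An affine point of the ellipse on a tangent line of the caustic is one of the two impact
points. -/
theorem affinePt_eq_impact {a b g h : ℝ}
    (hE : a * K.cn h ^ 2 = α ^ 2 * K.dn h ^ 2) (hE' : b * K.cn h ^ 2 = β ^ 2)
    {p : EuclideanSpace ℝ (Fin 2)} (hp : (p 0) ^ 2 / a + (p 1) ^ 2 / b = 1)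
    (hl : On (affinePt p) (K.tangentLine g)) :
    affinePt p = K.impact (g - h) h ∨ affinePt p = K.impact (g + h) h := by
  have hd := (K.dn_pos h).ne'
  have ha : a ≠ 0 := by rintro rfl; simp [K.fst_ne_zero, hd] at hE
  have hb : b ≠ 0 := by
    rintro rfl
    exact pow_ne_zero 2 K.snd_ne_zero (by simpa using hE'.symm)
  have : affinePt p ∈ {y : Pt | On y (K.tangentLine g) ∧ OnConic (K.shiftConic h) y} := by
    refine ⟨hl, ?_⟩
    rw [affinePt, shiftConic, onConic_diagonal_mk_iff]
    simp only [Matrix.cons_val]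
    rw [← hE, ← hE']
    field_simp at hp
    linear_combination (-K.cn h ^ 4) * hp - b * K.cn h ^ 2 * hE
  rwa [K.tangentLine_inter_shiftConic] at this

/-- One step of the billiard: the caustic parameter of the line is shifted by `2 h`. -/
theorem billiard_step {a b g h : ℝ} (hc : K.cn h ≠ 0) (hE : a * K.cn h ^ 2 = α ^ 2 * K.dn h ^ 2)
    (hE' : b * K.cn h ^ 2 = β ^ 2) {p₀ p₁ p₂ : EuclideanSpace ℝ (Fin 2)} {l : Ln}
    (h₀ : affinePt p₀ = K.impact (g - h) h) (h₁ : affinePt p₁ = K.impact (g + h) h)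
    (hne : p₁ ≠ p₂) (hl₁ : On (affinePt p₁) l) (hl₂ : On (affinePt p₂) l)
    (hp : (p₂ 0) ^ 2 / a + (p₂ 1) ^ 2 / b = 1)
    (hr : (Submodule.span ℝ {ellipseNormal a b p₁})ᗮ.reflection (dir p₀ p₁) = dir p₁ p₂) :
    l = K.tangentLine (g + 2 * h) ∧ affinePt p₂ = K.impact (g + 3 * h) h := by
  have hv : β * K.sn (g + h - h) * dir p₀ p₁ 0 + α * K.cn (g + h - h) * dir p₀ p₁ 1 = 0 := by
    have e₀ := K.impact_on_tangentLine_add (g - h) h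
    have e₁ := K.impact_on_tangentLine_sub (g + h) h
    rw [sub_add_cancel, ← h₀, affinePt, tangentLine, on_mk_iff] at e₀
    rw [add_sub_cancel_right, ← h₁, affinePt, tangentLine, on_mk_iff] at e₁
    simp only [Matrix.cons_val] at e₀ e₁
    rw [add_sub_cancel_right]
    simp only [dir, PiLp.smul_apply, PiLp.sub_apply, smul_eq_mul]
    linear_combination ‖p₁ - p₀‖⁻¹ * (e₁ - e₀)
  have hw := K.reflection_perp hc hE hE' h₁ hv
  rw [hr] at hw
  have e : g + h + h = g + 2 * h := by ring
  have on₁ := K.impact_on_tangentLine_add (g + h) h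
  rw [← h₁] at on₁
  rw [e] at hw on₁
  have on₂ : On (affinePt p₂) (K.tangentLine (g + 2 * h)) := by
    rw [affinePt, tangentLine, on_mk_iff] at on₁ ⊢
    have hn : ‖p₂ - p₁‖ ≠ 0 := norm_ne_zero_iff.2 (sub_ne_zero.2 hne.symm)
    simp only [dir, PiLp.smul_apply, PiLp.sub_apply, smul_eq_mul] at hw
    have hw' : β * K.sn (g + 2 * h) * (p₂ 0 - p₁ 0) + α * K.cn (g + 2 * h) * (p₂ 1 - p₁ 1) = 0 := by
      refine mul_left_cancel₀ (inv_ne_zero hn) ?_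
      linear_combination hw
    simp only [Matrix.cons_val] at on₁ ⊢
    linear_combination on₁ + hw'
  refine ⟨line_eq_of_affinePt_on hne hl₁ hl₂ on₁ on₂, ?_⟩
  rcases K.affinePt_eq_impact hE hE' hp on₂ with h₂ | h₂
  · refine absurd (affinePt_injective ?_) hne
    rw [h₁, h₂]
    congr 1
    ring
  · rw [h₂]
    congr 1
    ring

/-- A billiard trajectory one of whose lines touches the caustic consists of the tangent lines
whose parameters form an arithmetic progression. -/
theorem exists_tangentLine_eq {a b h : ℝ} (hc : K.cn h ≠ 0)
    (hE : a * K.cn h ^ 2 = α ^ 2 * K.dn h ^ 2) (hE' : b * K.cn h ^ 2 = β ^ 2)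
    {l : ℤ → Ln} (hl : IsEllipseBilliard a b l) {i₀ : ℤ} {g : ℝ}
    (h₀ : l i₀ = K.tangentLine g) :
    ∃ g' h' : ℝ, ∀ i : ℤ, l i = K.tangentLine (g' + i * (2 * h')) := by
  obtain ⟨p, hp⟩ := hl
  obtain ⟨hp₀, hne₀, hon₀, hon₁, -⟩ := hp i₀
  have hp₁ := (hp (i₀ + 1)).1
  rw [h₀] at hon₀ hon₁
  -- The direction of motion decides the sign of the shift; `cn` and `dn`, hence the conic, do not
  -- see it.
  have hstart : ∃ h', K.cn h' = K.cn h ∧ K.dn h' = K.dn h ∧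
      affinePt (p i₀) = K.impact (g - h') h' ∧ affinePt (p (i₀ + 1)) = K.impact (g + h') h' := by
    rcases K.affinePt_eq_impact hE hE' hp₀ hon₀ with e₀ | e₀ <;>
      rcases K.affinePt_eq_impact hE hE' hp₁ hon₁ with e₁ | e₁
    · exact absurd (affinePt_injective (e₀.trans e₁.symm)) hne₀
    · exact ⟨h, rfl, rfl, e₀, e₁⟩
    · refine ⟨-h, K.cn_neg h, K.dn_neg h, ?_, ?_⟩
      · rw [K.impact_neg, sub_neg_eq_add, e₀]
      · rw [K.impact_neg, ← sub_eq_add_neg, e₁]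
    · exact absurd (affinePt_injective (e₀.trans e₁.symm)) hne₀
  obtain ⟨h', hch, hdh, e₀, e₁⟩ := hstart
  rw [← hch] at hc hE hE'
  rw [← hdh] at hE
  clear hch hdh
  have hall : ∀ i : ℤ, ∃ x : ℝ, x = g + (i - i₀) * (2 * h') ∧ l i = K.tangentLine x ∧
      affinePt (p i) = K.impact (x - h') h' ∧ affinePt (p (i + 1)) = K.impact (x + h') h' := by
    intro i
    induction i using Int.inductionOn' (b := i₀) with
    | zero => exact ⟨g, by ring, h₀, e₀, e₁⟩
    | succ k _ ih =>
      obtain ⟨x, hx, -, f₀, f₁⟩ := ih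
      obtain ⟨-, hne, hl₁, hl₂, hr⟩ := hp (k + 1)
      rw [add_sub_cancel_right] at hr
      obtain ⟨s₁, s₂⟩ := K.billiard_step hc hE hE' f₀ f₁ hne hl₁ hl₂ (hp (k + 1 + 1)).1 hr
      refine ⟨x + 2 * h', by rw [hx]; push_cast; ring, s₁, ?_, ?_⟩
      · rw [f₁]; congr 1; ring
      · rw [s₂]; congr 1; ring
    | pred k _ ih =>
      obtain ⟨x, hx, -, f₀, f₁⟩ := ih
      obtain ⟨hpk, hne, hl₁, hl₂, -⟩ := hp (k - 1)
      have hr := (hp k).2.2.2.2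
      rw [sub_add_cancel] at hne hl₂
      -- Going backwards, the reversed motion obeys the same law, with shift `-h'`.
      have hr' : (Submodule.span ℝ {ellipseNormal a b (p k)})ᗮ.reflection
          (dir (p (k + 1)) (p k)) = dir (p k) (p (k - 1)) := by
        rw [dir_comm, ← hr, map_neg, Submodule.reflection_reflection, ← dir_comm]
      have c' : K.cn (-h') = K.cn h' := K.cn_neg h'
      have d' : K.dn (-h') = K.dn h' := K.dn_neg h'
      obtain ⟨s₁, s₂⟩ := K.billiard_step (h := -h') (g := x) (by rwa [c']) (by rwa [c', d'])
        (by rwa [c']) (by rwa [K.impact_neg, sub_neg_eq_add])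
        (by rwa [K.impact_neg, ← sub_eq_add_neg]) hne.symm hl₂ hl₁ hpk hr'
      refine ⟨x - 2 * h', by rw [hx]; push_cast; ring, ?_, ?_, ?_⟩
      · rw [s₁]; congr 1; ring
      · rw [s₂, K.impact_neg]; congr 1; ring
      · rw [sub_add_cancel, f₀]; congr 1; ring
  refine ⟨g - i₀ * (2 * h'), h', fun i => ?_⟩
  obtain ⟨x, hx, hl, -⟩ := hall i
  rw [hl, hx]
  congr 1
  ring

/-- A tangent line of the caustic that meets the ellipse in two points lies outside the caustic. -/
theorem pos_of_tangentLine_chord {c g : ℝ} (ha : 0 < α ^ 2 + c) (hb : 0 < β ^ 2 + c)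
    {p p' : EuclideanSpace ℝ (Fin 2)} (hne : p ≠ p')
    (hp : (p 0) ^ 2 / (α ^ 2 + c) + (p 1) ^ 2 / (β ^ 2 + c) = 1)
    (hp' : (p' 0) ^ 2 / (α ^ 2 + c) + (p' 1) ^ 2 / (β ^ 2 + c) = 1)
    (hl : On (affinePt p) (K.tangentLine g)) (hl' : On (affinePt p') (K.tangentLine g)) :
    0 < c := by
  by_contra! hc
  have hα := K.fst_pos
  have hβ := K.snd_pos
  have key : ∀ x : EuclideanSpace ℝ (Fin 2),
      (x 0) ^ 2 / (α ^ 2 + c) + (x 1) ^ 2 / (β ^ 2 + c) = 1 →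
      On (affinePt x) (K.tangentLine g) → x 0 = α * K.sn g ∧ x 1 = β * K.cn g := by
    intro x hx hl
    rw [affinePt, tangentLine, on_mk_iff] at hl
    simp only [Matrix.cons_val] at hl
    have l₀ : (x 0 / α) ^ 2 ≤ x 0 ^ 2 / (α ^ 2 + c) := by
      rw [div_pow]; gcongr; linarith
    have l₁ : (x 1 / β) ^ 2 ≤ x 1 ^ 2 / (β ^ 2 + c) := by
      rw [div_pow]; gcongr; linarith
    have hl : x 0 / α * K.sn g + x 1 / β * K.cn g = 1 := by
      field_simp
      linear_combination hl
    -- For `c ≤ 0` the ellipse lies within the closed caustic, so `(x/α, y/β)` is in the unit disc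
    -- while its product with the unit vector `(sn g, cn g)` is 1. The equality case of
    -- Cauchy–Schwarz leaves only the point of contact.
    have hsum : (x 0 / α - K.sn g) ^ 2 + (x 1 / β - K.cn g) ^ 2 ≤ 0 := by
      nlinarith [K.sq_add_sq g]
    have z₀ : x 0 / α - K.sn g = 0 := by
      nlinarith [sq_nonneg (x 0 / α - K.sn g), sq_nonneg (x 1 / β - K.cn g)]
    have z₁ : x 1 / β - K.cn g = 0 := by
      nlinarith [sq_nonneg (x 0 / α - K.sn g), sq_nonneg (x 1 / β - K.cn g)]
    rw [← sub_eq_zero.1 z₀, ← sub_eq_zero.1 z₁]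
    constructor <;> field_simp
  apply hne
  ext i
  fin_cases i
  · exact (key p hp hl).1.trans (key p' hp' hl').1.symm
  · exact (key p hp hl).2.trans (key p' hp' hl').2.symm

/-! ### Assembling the net -/

include K in
theorem axisConic_mem_confocalOf (c : ℝ) :
    axisConic (α ^ 2) (β ^ 2) ∈ confocalOf (α ^ 2 + c) (β ^ 2 + c) := by
  have ha := K.fst_ne_zero
  have hb := K.snd_ne_zero
  refine diagonal_mem_confocalOf (s := 1) (t := -c) (r := -(α ^ 2 * β ^ 2)⁻¹) (by simp)
    (by simp [*]) ?_ ?_ ?_ <;> field_simp <;> ring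

theorem isDoubleReflectionNet (c g h : ℝ) {m : ℕ} (k : Fin m → ℕ) :
    IsDoubleReflectionNet (confocalOf (α ^ 2 + c) (β ^ 2 + c)) (axisConic (α ^ 2) (β ^ 2))
      (fun n : Fin m → ℤ => K.tangentLine (g + (∑ j, n j * (k j : ℤ) : ℤ) * (2 * h))) := by
  have hsum : ∀ (n : Fin m → ℤ) (i : ℤ) (j : Fin m),
      ∑ x, (n + i • (Pi.single j 1 : Fin m → ℤ)) x * (k x : ℤ) = ∑ x, n x * (k x : ℤ) + i * k j := by
    intro n i j
    simp [add_mul, Finset.sum_add_distrib, Pi.single_apply]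
  have hsum' : ∀ (n : Fin m → ℤ) (j : Fin m),
      ∑ x, (n + (Pi.single j 1 : Fin m → ℤ)) x * (k x : ℤ) = ∑ x, n x * (k x : ℤ) + k j := by
    intro n j
    simpa using hsum n 1 j
  refine ⟨K.axisConic_mem_confocalOf c, fun n => K.touches_tangentLine _,
    fun j => K.shiftConic (k j * h), fun j => K.shiftConic_mem c _, fun j n => ?_,
    fun i j _ n => ?_⟩
  · convert K.isBilliardTrajectory_tangentLine c
      (g + (∑ j, n j * (k j : ℤ) : ℤ) * (2 * h)) (k j * h) using 3 with i
    rw [hsum]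
    push_cast
    ring
  · convert K.isDoubleReflectionConfiguration_tangentLine c
      (g + (∑ j, n j * (k j : ℤ) : ℤ) * (2 * h)) (k i * h) (k j * h) using 2 <;>
    · simp only [hsum']
      push_cast
      ring

end TangentParam

end DoubleReflection

end

/-- Let `(l i)` be a billiard trajectory within the ellipse `x² / a + y² / b = 1`, `a > b > 0`,
whose caustic is the confocal ellipse `x² / (a - c) + y² / (b - c) = 1`, `c < b` (that is, a line of
the trajectory touches it). For positive integers `k₁, …, kₘ`, the map
`(n₁, …, nₘ) ↦ l (n₁ k₁ + ⋯ + nₘ kₘ)` is a double reflection net. -/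
theorem mainTheorem7 (a b : ℝ) (hb : 0 < b) (hab : b < a)
    (l : ℤ → DoubleReflection.Ln) (hl : DoubleReflection.IsEllipseBilliard a b l)
    (c : ℝ) (hc : c < b)
    (hC : ∃ i : ℤ, DoubleReflection.Touches (l i) (DoubleReflection.axisConic (a - c) (b - c)))
    (m : ℕ) (k : Fin m → ℕ) (hk : ∀ j, 0 < k j) :
    DoubleReflection.IsDoubleReflectionNet (DoubleReflection.confocalOf a b)
      (DoubleReflection.axisConic (a - c) (b - c))
      (fun n : Fin m → ℤ => l (∑ j, n j * (k j : ℤ))) := by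
  obtain ⟨α, hα, rfl⟩ : ∃ α : ℝ, 0 < α ∧ a = α ^ 2 + c :=
    ⟨√(a - c), Real.sqrt_pos.2 (by linarith), by rw [Real.sq_sqrt (by linarith)]; ring⟩
  obtain ⟨β, hβ, rfl⟩ : ∃ β : ℝ, 0 < β ∧ b = β ^ 2 + c :=
    ⟨√(b - c), Real.sqrt_pos.2 (by linarith), by rw [Real.sq_sqrt (by linarith)]; ring⟩
  rw [add_sub_cancel_right, add_sub_cancel_right] at hC ⊢
  have hq0 : 0 ≤ 1 - β ^ 2 / α ^ 2 := by
    rw [sub_nonneg, div_le_one (by positivity)]; linarith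
  have hq1 : 1 - β ^ 2 / α ^ 2 < 1 := by
    have : 0 < β ^ 2 / α ^ 2 := by positivity
    linarith
  obtain ⟨J⟩ := DoubleReflection.nonempty_jacobiFunctions hq0 hq1
  let K : DoubleReflection.TangentParam α β (1 - β ^ 2 / α ^ 2) :=
    { J with
      fst_pos := hα
      snd_pos := hβ
      parameter_nonneg := hq0
      parameter_mul := by field_simp }
  obtain ⟨i₀, hi₀⟩ := hC
  obtain ⟨g, hg⟩ := K.exists_eq_tangentLine hi₀
  have hc0 : 0 < c := by
    obtain ⟨p, hp⟩ := hl
    obtain ⟨h₁, h₂, h₃, h₄, -⟩ := hp i₀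
    rw [hg] at h₃ h₄
    exact K.pos_of_tangentLine_chord (hb.trans hab) hb h₂ h₁ (hp (i₀ + 1)).1 h₃ h₄
  have hr : β ^ 2 / (β ^ 2 + c) ≤ 1 := by
    rw [div_le_one hb]; linarith
  -- This value of `cn h` makes `shiftConic h` the billiard ellipse: `cn² h = β² / (β² + c)`. Such
  -- `h` exists because `c > 0`.
  obtain ⟨h, -, hch⟩ := K.surj √(1 - β ^ 2 / (β ^ 2 + c)) √(β ^ 2 / (β ^ 2 + c)) (by
    rw [Real.sq_sqrt (by linarith), Real.sq_sqrt (by positivity)]; ring)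
  have hcn : K.cn h ≠ 0 := by rw [hch]; positivity
  have hE' : (β ^ 2 + c) * K.cn h ^ 2 = β ^ 2 := by
    rw [hch, Real.sq_sqrt (by positivity)]; field_simp
  have hE : (α ^ 2 + c) * K.cn h ^ 2 = α ^ 2 * K.dn h ^ 2 := by
    linear_combination hE' - K.sq_mul_dn_sq h
  obtain ⟨g', h', hl'⟩ := K.exists_tangentLine_eq hcn hE hE' hl hg
  simp only [hl']
  exact K.isDoubleReflectionNet c g' h' k
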